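/- Let $H,S,\Delta_H,\Delta_S$ be $n\times n$ complex Hermitian matrices with $S$ positive semidefinite, and put $\tilde H=H+\Delta_H$, $\tilde S=S+\Delta_S$, $\eta_H=\|\Delta_H\|$, $\eta_S=\|\Delta_S\|$, where $\|\cdot\|$ is the spectral norm. Let $v_1,\dots,v_n$ be an orthonormal basis of eigenvectors of $S$ with eigenvalues $\lambda_1\ge\dots\ge\lambda_n\ge 0$, and $\tilde v_1,\dots,\tilde v_n$ an orthonormal basis of eigenvectors of $\tilde S$ with eigenvalues $\tilde\lambda_1\ge\dots\ge\tilde\lambda_n$. Let $\epsilon>0$, let $V$ be the matrix whose columns are the $v_i$ with $\lambda_i>\epsilon$, and $\tilde V$ the matrix whose columns are the $\tilde v_i$ with $\tilde\lambda_i>\epsilon$. Assume: 1. for some $\mu>0$ and $0\le\alpha\le 1/2$, $|v_i^*Hv_j|\le\mu\,\min(\lambda_i,\lambda_j)^{1-\alpha}\max(\lambda_i,\lambda_j)^{\alpha}$ for all $1\le i,j\le n$; 2. for some $\rho>0$ and some index $1\le m\le n$, $\lambda_{m+1}+\eta_S\le\epsilon<(1+\rho)\epsilon\le\lambda_m$ (the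 first inequality is void if $m=n$); 3. $(1+\rho^{-1})\eta_S/\epsilon\le 1$. Put $(A,B)=(V^*HV,V^*SV)$ and $$\chi=3(2+\mu)n^3(1+\rho^{-1})\Big(\frac{\|S\|}{\epsilon}\Big)^{\alpha}\eta_S+\eta_H .$$ An eigenvalue of a pair $(M,N)$ is a number $E$ with $Mx=E\,Nx$ for some $x\ne0$, called an eigenvector. Then there is a pair $(A',B')$ with $$\sqrt{\|A'-A\|^2+\|B'-B\|^2}\le\chi$$ that is $*$-congruent to the thresholded noisy pair $(\tilde V^*\tilde H\tilde V,\tilde V^*\tilde S\tilde V)$, that is, $(A',B')=(W^*\tilde V^*\tilde H\tilde VW,\,W^*\tilde V^*\tilde S\tilde VW)$ for some invertible $W$; in particular the two pairs have the same eigenvalues, with multiplicities. Let $E_0\le E_1\le\dots\le E_{m-1}$ be the eigenvalues of $(A,B)$, repeated by multiplicity, let $x_0$ be a unit eigenvector of $(A,B)$ for $E_0$, and let $d_0=|x_0^*(A+\mathrm iB)x_0|$ (so that $d_0^{-1}$ is the condition number of the eigenangle $\tan^{-1}E_0$). Suppose further that $n\chi\le\epsilon$ and, if $m\ge2$, that $\tan^{-1}E_1-\tan^{-1}E_0\ge\sin^{-1}(n\chi/\epsilon)$.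 Then $(\tilde V^*\tilde H\tilde V,\tilde V^*\tilde S\tilde V)$ has a least eigenvalue $\tilde E_0$ (the value recovered by thresholding), and $$\left|\tan^{-1}E_0-\tan^{-1}\tilde E_0\right|\le\sin^{-1}\frac{n\chi}{d_0}.$$ -/

import Mathlib

open Matrix
open scoped Matrix.Norms.L2Operator ComplexOrder

/-- `(V, lam)` is an eigendecomposition of the `n × n` matrix `S`: the columns of the unitary
matrix `V` are eigenvectors of `S`, arranged in decreasing order of their (real) eigenvalues. -/
structure IsEigendecomposition {n : ℕ} (S V : Matrix (Fin n) (Fin n) ℂ) (lam : Fin n → ℝ) :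
    Prop where
  unitary : V ∈ Matrix.unitaryGroup (Fin n) ℂ
  antitone : Antitone lam
  eigen : S * V = V * Matrix.diagonal (fun i => (lam i : ℂ))

/-- The indices of the eigenvalues that survive thresholding at level `ε`. -/
abbrev Kept {n : ℕ} (lam : Fin n → ℝ) (ε : ℝ) : Type := {i : Fin n // ε < lam i}

/-- The columns of `V` that belong to eigenvalues greater than `ε`. -/
def keptColumns {n : ℕ} (V : Matrix (Fin n) (Fin n) ℂ) (lam : Fin n → ℝ) (ε : ℝ) :
    Matrix (Fin n) (Kept lam ε) ℂ :=
  V.submatrix id Subtype.val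

/-- The compression `V_{>ε}ᴴ M V_{>ε}` of `M` to the eigenvectors that survive thresholding. -/
noncomputable def thresholded {n : ℕ} (M V : Matrix (Fin n) (Fin n) ℂ) (lam : Fin n → ℝ)
    (ε : ℝ) : Matrix (Kept lam ε) (Kept lam ε) ℂ :=
  (keptColumns V lam ε)ᴴ * M * keptColumns V lam ε

/-- The weighted geometric mean bound
`|v_iᴴ H v_j| ≤ μ min(λ_i, λ_j)^(1-α) max(λ_i, λ_j)^α`, where `v_i` is the `i`-th column of `V`. -/
def GeometricMeanBound {n : ℕ} (H V : Matrix (Fin n) (Fin n) ℂ) (lam : Fin n → ℝ)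
    (μ α : ℝ) : Prop :=
  ∀ i j, ‖star (V.col i) ⬝ᵥ (H *ᵥ V.col j)‖ ≤
    μ * min (lam i) (lam j) ^ (1 - α) * max (lam i) (lam j) ^ α

/-- The gap condition `λ_{m+1} + η ≤ ε < (1+ρ) ε ≤ λ_m` for an index `1 ≤ m ≤ n`, the eigenvalues
being numbered from one in the text and from zero in the code. For `m = n` there is no
`λ_{m+1}`, and the first inequality is void. -/
def SpectralGap {n : ℕ} (lam : Fin n → ℝ) (m : ℕ) (η ε ρ : ℝ) : Prop :=
  0 < m ∧ m ≤ n ∧ (∀ i : Fin n, i.val = m → lam i + η ≤ ε) ∧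
    ε < (1 + ρ) * ε ∧ (∀ i : Fin n, i.val + 1 = m → (1 + ρ) * ε ≤ lam i)

/-- `E` is an eigenvalue of the pair `(A, B)` with eigenvector `x`: `A x = E B x`, `x ≠ 0`. -/
def IsPairEigenvector {ι : Type*} [Fintype ι] (A B : Matrix ι ι ℂ) (E : ℝ) (x : ι → ℂ) : Prop :=
  x ≠ 0 ∧ A *ᵥ x = (E : ℂ) • (B *ᵥ x)

/-- The (real) eigenvalues of the pair `(A, B)`; a Hermitian pair with `B` positive definite has
no others. -/
def pairEigenvalues {ι : Type*} [Fintype ι] (A B : Matrix ι ι ℂ) : Set ℝ :=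
  {E | ∃ x, IsPairEigenvector A B E x}

/-- `E 0 ≤ E 1 ≤ …` are all the eigenvalues of the pair `(A, B)`, repeated by multiplicity
(for a Hermitian pair with `B` positive definite). -/
def IsEigenvalueSequence {ι : Type*} [Fintype ι] (A B : Matrix ι ι ℂ) {q : ℕ}
    (E : Fin q → ℝ) : Prop :=
  Monotone E ∧ ∃ x : Module.Basis (Fin q) ℂ (ι → ℂ), ∀ j, IsPairEigenvector A B (E j) (x j)

/-- The pair `(A', B')` is `(Wᴴ A W, Wᴴ B W)` for some invertible `W`. -/
def StarCongruent {ι κ : Type*} [Fintype ι] [DecidableEq ι] [Fintype κ] [DecidableEq κ]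
    (A B : Matrix ι ι ℂ) (A' B' : Matrix κ κ ℂ) : Prop :=
  ∃ (W : Matrix ι κ ℂ) (W' : Matrix κ ι ℂ), W * W' = 1 ∧ W' * W = 1 ∧
    A' = Wᴴ * A * W ∧ B' = Wᴴ * B * W

/-- `|xᴴ (A + iB) x|`. For a unit eigenvector `x` of a simple eigenvalue `E` of `(A, B)`, this is
the reciprocal of the condition number of the eigenangle `arctan E`. -/
noncomputable def eigenangleDist {ι : Type*} [Fintype ι] (A B : Matrix ι ι ℂ) (x : ι → ℂ) : ℝ :=
  ‖star x ⬝ᵥ ((A + Complex.I • B) *ᵥ x)‖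

/-- The error level
`χ = 3 (2 + μ) n³ (1 + ρ⁻¹) (‖S‖ / ε)^α ηS + ηH`, with `‖S‖` the spectral norm. -/
noncomputable def errorLevel {n : ℕ} (S : Matrix (Fin n) (Fin n) ℂ) (μ α ρ ε ηS ηH : ℝ) : ℝ :=
  3 * (2 + μ) * (n : ℝ) ^ 3 * (1 + ρ⁻¹) * (‖S‖ / ε) ^ α * ηS + ηH

/-! Let `P` be the orthogonal projection onto the kept eigenvectors of `S + ΔS`, and `W` the overlap
matrix of the kept columns of `Ṽ` and `V`. Then `Wᴴ * At * W` is the compression of `H + ΔH` to the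
vectors `P v_i`, with `v_i` the kept eigenvectors of `S`. It is close to `A` because `P` moves these
vectors little, and `W` is invertible because a vector in one kept space orthogonal to the other
would give incompatible values of the forms of `S` and `S + ΔS` (`exists_overlap_inverse`).

In the eigenbasis of `S`, `P` becomes `1 - q` with `‖q i j‖ ≤ l i * l j`, where the leakage `l i` is
the distance from `v_i` to the range of `P`. A Davis–Kahan argument gives `l i * lam i ≤ (1 + ρ⁻¹) *
‖ΔS‖` for kept `i`, and `l i * lam i ≤ ε` holds for all `i`. Every error term carries at least two
leakages. One, set against the geometric mean bound, gives `μ * ε * (‖S‖ / ε) ^ α`; the other, at a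
kept index, replaces `ε` by `(1 + ρ⁻¹) * ‖ΔS‖` (`norm_overlap_congruence_sub_le`). The matrix `S`
obeys the geometric mean bound with `μ = 1`, so `B` is treated alike.

The eigenangle bound is variational (`abs_arctan_sub_arctan_le`). The form of `A cos ψ - B sin ψ`
changes sign when the angle of the Rayleigh quotient crosses `ψ`, and the perturbation moves it by
at most `χ` on unit vectors. With `d₀ sin φ = n χ`, its value at `x₀` for `ψ = arctan E₀ ± φ` is `∓
n χ`. For the upper bound `x₀` is a trial vector. For the lower bound the form must be at least `χ`
on every unit vector: the gap gives `n χ` on the span of the other eigenvectors, and `n ≥ 2` pays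
for their not being Euclidean-orthogonal to `x₀`. -/

/-- The real part of the quadratic form `xᴴ M x`. -/
noncomputable def quadForm {ι : Type*} [Fintype ι] (M : Matrix ι ι ℂ) (x : ι → ℂ) : ℝ :=
  (star x ⬝ᵥ (M *ᵥ x)).re

/-- The squared Euclidean norm of a complex vector. -/
noncomputable def sqNorm {ι : Type*} [Fintype ι] (x : ι → ℂ) : ℝ := ∑ i, ‖x i‖ ^ 2

/-! ### Quadratic forms and Euclidean norms -/

section Forms

variable {ι κ : Type*} [Fintype ι] [Fintype κ]

theorem sqNorm_nonneg (x : ι → ℂ) : 0 ≤ sqNorm x := Finset.sum_nonneg fun _ _ => by positivity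

theorem sqNorm_eq_norm_sq (x : ι → ℂ) :
    sqNorm x = ‖(WithLp.toLp 2 x : EuclideanSpace ℂ ι)‖ ^ 2 := by
  rw [EuclideanSpace.norm_sq_eq]; rfl

theorem sqNorm_pos {x : ι → ℂ} (hx : x ≠ 0) : 0 < sqNorm x := by
  rw [sqNorm_eq_norm_sq]
  have : (WithLp.toLp 2 x : EuclideanSpace ℂ ι) ≠ 0 := by simpa using hx
  positivity

theorem star_dotProduct_self (x : ι → ℂ) : star x ⬝ᵥ x = (sqNorm x : ℂ) := by
  simp [dotProduct, sqNorm, Complex.conj_mul']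

theorem sqNorm_smul (c : ℂ) (x : ι → ℂ) : sqNorm (c • x) = ‖c‖ ^ 2 * sqNorm x := by
  simp [sqNorm, mul_pow, Finset.mul_sum]

/-- Eigenvectors of a pair are orthogonal for `B` but not for the Euclidean product, so the factor 2
cannot be dropped. -/
theorem sqNorm_add_le (x y : ι → ℂ) : sqNorm (x + y) ≤ 2 * (sqNorm x + sqNorm y) := by
  simp only [sqNorm_eq_norm_sq, WithLp.toLp_add]
  have h := norm_add_le (WithLp.toLp 2 x : EuclideanSpace ℂ ι) (WithLp.toLp 2 y)
  have h0 := norm_nonneg (WithLp.toLp 2 x + WithLp.toLp 2 y : EuclideanSpace ℂ ι)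
  nlinarith [sq_nonneg (‖(WithLp.toLp 2 x : EuclideanSpace ℂ ι)‖ -
    ‖(WithLp.toLp 2 y : EuclideanSpace ℂ ι)‖)]

theorem quadForm_add (M N : Matrix ι ι ℂ) (x : ι → ℂ) :
    quadForm (M + N) x = quadForm M x + quadForm N x := by
  simp [quadForm, add_mulVec, dotProduct_add]

theorem quadForm_sub (M N : Matrix ι ι ℂ) (x : ι → ℂ) :
    quadForm (M - N) x = quadForm M x - quadForm N x := by
  simp [quadForm, sub_mulVec, dotProduct_sub]

theorem quadForm_ofReal_smul (r : ℝ) (M : Matrix ι ι ℂ) (x : ι → ℂ) :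
    quadForm ((r : ℂ) • M) x = r * quadForm M x := by
  simp [quadForm, smul_mulVec]

theorem quadForm_smul (M : Matrix ι ι ℂ) (c : ℂ) (x : ι → ℂ) :
    quadForm M (c • x) = ‖c‖ ^ 2 * quadForm M x := by
  have : star (c • x) ⬝ᵥ (M *ᵥ (c • x)) = ((‖c‖ ^ 2 : ℝ) : ℂ) * (star x ⬝ᵥ (M *ᵥ x)) := by
    rw [star_smul, mulVec_smul, smul_dotProduct, dotProduct_smul, smul_eq_mul, smul_eq_mul,
      ← mul_assoc]
    simp [Complex.conj_mul']
  rw [quadForm, this, Complex.re_ofReal_mul, quadForm]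

theorem quadForm_conjTranspose_mul_mul (M : Matrix ι ι ℂ) (W : Matrix ι κ ℂ) (x : κ → ℂ) :
    quadForm (Wᴴ * M * W) x = quadForm M (W *ᵥ x) := by
  simp only [quadForm, ← mulVec_mulVec, star_mulVec, dotProduct_mulVec, vecMul_vecMul,
    Matrix.mul_assoc]

theorem coe_quadForm {M : Matrix ι ι ℂ} (hM : M.IsHermitian) (x : ι → ℂ) :
    (quadForm M x : ℂ) = star x ⬝ᵥ (M *ᵥ x) := by
  have := hM.im_star_dotProduct_mulVec_self x
  apply Complex.ext
  · simp [quadForm]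
  · simpa using this.symm

theorem star_dotProduct_mulVec_comm {M : Matrix ι ι ℂ} (hM : M.IsHermitian) (x y : ι → ℂ) :
    star x ⬝ᵥ (M *ᵥ y) = star (star y ⬝ᵥ (M *ᵥ x)) := by
  rw [star_dotProduct, star_mulVec, hM.eq, ← dotProduct_mulVec]

theorem IsPairEigenvector.quadForm_eq {A B : Matrix ι ι ℂ} {E : ℝ} {x : ι → ℂ}
    (h : IsPairEigenvector A B E x) : quadForm A x = E * quadForm B x := by
  rw [quadForm, h.2, dotProduct_smul, smul_eq_mul, Complex.re_ofReal_mul, quadForm]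

variable [DecidableEq κ]

theorem sqNorm_mulVec_le (M : Matrix ι κ ℂ) (x : κ → ℂ) :
    sqNorm (M *ᵥ x) ≤ ‖M‖ ^ 2 * sqNorm x := by
  rw [sqNorm_eq_norm_sq, sqNorm_eq_norm_sq, ← mul_pow]
  exact pow_le_pow_left₀ (norm_nonneg _) (M.l2_opNorm_mulVec (WithLp.toLp 2 x)) 2

variable [DecidableEq ι]

theorem abs_quadForm_le (M : Matrix ι ι ℂ) (x : ι → ℂ) : |quadForm M x| ≤ ‖M‖ * sqNorm x := by
  refine (Complex.abs_re_le_norm _).trans ?_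
  have h1 : star x ⬝ᵥ (M *ᵥ x) = inner ℂ (WithLp.toLp 2 x : EuclideanSpace ℂ ι)
      (WithLp.toLp 2 (M *ᵥ x)) := by
    rw [EuclideanSpace.inner_toLp_toLp, dotProduct_comm]
  have h2 := M.l2_opNorm_mulVec (WithLp.toLp 2 x)
  rw [h1, sqNorm_eq_norm_sq]
  calc _ ≤ ‖(WithLp.toLp 2 x : EuclideanSpace ℂ ι)‖ *
        ‖(WithLp.toLp 2 (M *ᵥ x) : EuclideanSpace ℂ ι)‖ := norm_inner_le_norm _ _
    _ ≤ ‖(WithLp.toLp 2 x : EuclideanSpace ℂ ι)‖ *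
        (‖M‖ * ‖(WithLp.toLp 2 x : EuclideanSpace ℂ ι)‖) := by gcongr; exact h2
    _ = _ := by ring

theorem sum_norm_sq_row_le (M : Matrix ι κ ℂ) (i : ι) : ∑ k, ‖M i k‖ ^ 2 ≤ ‖M‖ ^ 2 := by
  have h := sqNorm_mulVec_le Mᴴ (Pi.single i 1)
  rw [l2_opNorm_conjTranspose] at h
  simpa [sqNorm, Pi.single_apply, apply_ite] using h

theorem norm_le_card_mul_of_entry_le (M : Matrix ι ι ℂ) {c : ℝ} (hc : 0 ≤ c)
    (h : ∀ i j, ‖M i j‖ ≤ c) : ‖M‖ ≤ Fintype.card ι * c := by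
  rw [l2_opNorm_def]
  refine ContinuousLinearMap.opNorm_le_bound _ (by positivity) fun x => ?_
  refine (sq_le_sq₀ (norm_nonneg _) (by positivity)).mp ?_
  have h1 : ∀ i, ‖(M *ᵥ x) i‖ ^ 2 ≤ Fintype.card ι * (c ^ 2 * ‖x‖ ^ 2) := by
    intro i
    have h2 : ‖(M *ᵥ x) i‖ ≤ ∑ j, c * ‖x j‖ := by
      refine (norm_sum_le _ _).trans (Finset.sum_le_sum fun j _ => ?_)
      rw [norm_mul]; gcongr; exact h i j
    calc _ ≤ (∑ j, c * ‖x j‖) ^ 2 := by gcongr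
      _ ≤ Fintype.card ι * ∑ j, (c * ‖x j‖) ^ 2 := sq_sum_le_card_mul_sum_sq
      _ = _ := by simp [EuclideanSpace.norm_sq_eq, mul_pow, Finset.mul_sum]
  calc _ = ∑ i, ‖(M *ᵥ x) i‖ ^ 2 := EuclideanSpace.norm_sq_eq _
    _ ≤ ∑ _i : ι, Fintype.card ι * (c ^ 2 * ‖x‖ ^ 2) := Finset.sum_le_sum fun i _ => h1 i
    _ = _ := by simp; ring

end Forms

/-! ### Minimum of the Rayleigh quotient -/

section Rayleigh

variable {ι : Type*} [Fintype ι]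

theorem quadForm_pos {B : Matrix ι ι ℂ} (hB : B.PosDef) {x : ι → ℂ} (hx : x ≠ 0) :
    0 < quadForm B x :=
  (Complex.lt_def.mp (hB.dotProduct_mulVec_pos hx)).1

theorem continuous_quadForm (M : Matrix ι ι ℂ) : Continuous (quadForm M) := by
  unfold quadForm; fun_prop

/-- A Hermitian pair with positive definite second entry has an eigenvector at which the Rayleigh
quotient is minimal. -/
theorem exists_min_pairEigenvector [Nonempty ι] {A B : Matrix ι ι ℂ} (hA : A.IsHermitian)
    (hB : B.PosDef) : ∃ (E : ℝ) (x : ι → ℂ), IsPairEigenvector A B E x ∧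
      ∀ y, E * quadForm B y ≤ quadForm A y := by
  classical
  -- The sphere is that of the sup norm. Compactness and the common scaling of both forms are all
  -- that is needed.
  have hcont : ContinuousOn (fun x => quadForm A x / quadForm B x)
      (Metric.sphere (0 : ι → ℂ) 1) := by
    refine (continuous_quadForm A).continuousOn.div (continuous_quadForm B).continuousOn ?_
    intro x hx
    exact (quadForm_pos hB (ne_zero_of_mem_unit_sphere (⟨x, hx⟩ : Metric.sphere _ _))).ne'
  obtain ⟨x, hx, hmin⟩ := (isCompact_sphere (0 : ι → ℂ) 1).exists_isMinOn
    (NormedSpace.sphere_nonempty.mpr zero_le_one) hcont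
  have hx0 : x ≠ 0 := ne_zero_of_mem_unit_sphere (⟨x, hx⟩ : Metric.sphere _ _)
  set E := quadForm A x / quadForm B x with hE
  have hle : ∀ y, E * quadForm B y ≤ quadForm A y := by
    intro y
    by_cases hy : y = 0
    · simp [hy, quadForm]
    have hny : ‖y‖ ≠ 0 := norm_ne_zero_iff.mpr hy
    have hm : ((‖y‖ : ℂ)⁻¹ • y) ∈ Metric.sphere (0 : ι → ℂ) 1 := by
      simp [norm_smul, hny]
    have h := hmin hm
    simp only [Set.mem_ofPred_eq, quadForm_smul] at h
    rw [mul_div_mul_left _ _ (by simpa using hny)] at h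
    exact (le_div_iff₀ (quadForm_pos hB hy)).mp h
  refine ⟨E, x, ⟨hx0, ?_⟩, hle⟩
  have hherm : (A - (E : ℂ) • B).IsHermitian := by
    refine hA.sub ?_
    rw [IsHermitian, conjTranspose_smul, hB.isHermitian.eq]; simp
  -- Minimality makes `A - E B` positive semidefinite, and such a matrix kills every vector at which
  -- its form vanishes.
  have hpsd : (A - (E : ℂ) • B).PosSemidef := by
    refine .of_dotProduct_mulVec_nonneg hherm fun y => ?_
    rw [← coe_quadForm hherm, quadForm_sub, quadForm_ofReal_smul]
    exact_mod_cast sub_nonneg.mpr (hle y)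
  have h0 := (hpsd.dotProduct_mulVec_zero_iff x).mp (by
    rw [← coe_quadForm hherm, quadForm_sub, quadForm_ofReal_smul, hE,
      div_mul_cancel₀ _ (quadForm_pos hB hx0).ne', sub_self, Complex.ofReal_zero])
  rwa [sub_mulVec, smul_mulVec, sub_eq_zero] at h0

end Rayleigh

/-! ### Trigonometry of eigenangles -/

section Angles

/-- The point `(b, E b)` has polar angle `arctan E`. Its distance from the origin is the number `d₀`
when `b` is the form of `B` at `x₀`. -/
theorem mul_cos_sub_mul_sin {b : ℝ} (hb : 0 < b) (E ψ : ℝ) :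
    E * b * Real.cos ψ - b * Real.sin ψ =
      √((E * b) ^ 2 + b ^ 2) * Real.sin (Real.arctan E - ψ) := by
  have h1 : √((E * b) ^ 2 + b ^ 2) = b * √(1 + E ^ 2) := by
    rw [show (E * b) ^ 2 + b ^ 2 = b ^ 2 * (1 + E ^ 2) by ring, Real.sqrt_mul (sq_nonneg b),
      Real.sqrt_sq hb.le]
  have h2 : √(1 + E ^ 2) ≠ 0 := by positivity
  rw [h1, Real.sin_sub, Real.sin_arctan, Real.cos_arctan]
  field_simp

/-- This turns the gap between eigenangles into a lower bound for the rotated form on the higher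
eigenvectors. Since `E cos ψ - sin ψ = sin (θ₁ - ψ) / cos θ₁`, it suffices that `sin (θ₁ - ψ)`
dominates `(s / ε) cos θ₁`. -/
theorem le_mul_cos_sub_sin_of_arcsin_le {s ε E θ ψ : ℝ} (hε : 0 < ε) (hs : 0 ≤ s) (hsε : s ≤ ε)
    (hψ : -(Real.pi / 2) < ψ) (hψθ : ψ ≤ θ) (hgap : Real.arcsin (s / ε) ≤ Real.arctan E - θ) :
    s ≤ ε * (E * Real.cos ψ - Real.sin ψ) := by
  set β := Real.arcsin (s / ε) with hβ
  set θ₁ := Real.arctan E with hθ₁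
  have hs1 : s / ε ≤ 1 := (div_le_one hε).mpr hsε
  have hs0 : 0 ≤ s / ε := by positivity
  have hsinβ : Real.sin β = s / ε := Real.sin_arcsin (by linarith) hs1
  have hβ0 : 0 ≤ β := Real.arcsin_nonneg.mpr hs0
  have hβ1 : β ≤ Real.pi / 2 := Real.arcsin_le_pi_div_two _
  have hθ₁' : θ₁ < Real.pi / 2 := Real.arctan_lt_pi_div_two E
  have hcos : 0 < Real.cos θ₁ := Real.cos_arctan_pos E
  have hcos1 : Real.cos θ₁ ≤ 1 := Real.cos_le_one _
  have key : s / ε * Real.cos θ₁ ≤ Real.sin (θ₁ - ψ) := by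
    rcases le_or_gt (θ₁ - ψ) (Real.pi - β) with h | h
    · have h1 : Real.sin β ≤ Real.sin (θ₁ - ψ) := by
        rcases le_total (θ₁ - ψ) (Real.pi / 2) with h' | h'
        · exact Real.sin_le_sin_of_le_of_le_pi_div_two (by linarith) h' (by linarith)
        · rw [← Real.sin_pi_sub (θ₁ - ψ)]
          exact Real.sin_le_sin_of_le_of_le_pi_div_two (by linarith) (by linarith) (by linarith)
      rw [← hsinβ]
      have : 0 ≤ Real.sin β := hsinβ ▸ hs0
      nlinarith
    -- The angle may pass `π - β`, where the sine falls below `s / ε`; but `ψ > -π / 2` keeps it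
    -- above `cos θ₁`.
    · have h1 : Real.cos θ₁ ≤ Real.sin (θ₁ - ψ) := by
        rw [← Real.sin_pi_sub (θ₁ - ψ), ← Real.sin_pi_div_two_sub]
        exact Real.sin_le_sin_of_le_of_le_pi_div_two (by linarith) (by linarith) (by linarith)
      nlinarith
  have htan : E * Real.cos θ₁ = Real.sin θ₁ := by
    rw [hθ₁, Real.sin_arctan, Real.cos_arctan]; ring
  have h2 : s / ε * Real.cos θ₁ ≤ (E * Real.cos ψ - Real.sin ψ) * Real.cos θ₁ := by
    refine key.trans_eq ?_
    rw [Real.sin_sub, ← htan]; ring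
  have h3 := le_of_mul_le_mul_right h2 hcos
  rwa [div_le_iff₀' hε] at h3

theorem le_arctan_of_nonneg {E ψ : ℝ} (hψ : ψ < Real.pi / 2)
    (h : -(Real.pi / 2) < ψ → 0 ≤ E * Real.cos ψ - Real.sin ψ) : ψ ≤ Real.arctan E := by
  rcases le_or_gt ψ (-(Real.pi / 2)) with h' | h'
  · exact h'.trans (Real.neg_pi_div_two_lt_arctan E).le
  · have hc := Real.cos_pos_of_mem_Ioo ⟨h', hψ⟩
    rw [← Real.arctan_tan h' hψ]
    refine Real.arctan_mono ?_
    rw [Real.tan_eq_sin_div_cos, div_le_iff₀ hc]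
    linarith [h h']

theorem arctan_le_of_nonpos {E ψ : ℝ} (hψ : -(Real.pi / 2) < ψ)
    (h : ψ < Real.pi / 2 → E * Real.cos ψ - Real.sin ψ ≤ 0) : Real.arctan E ≤ ψ := by
  have := le_arctan_of_nonneg (E := -E) (ψ := -ψ) (by linarith) fun h' => by
    have := h (by linarith)
    rw [Real.cos_neg, Real.sin_neg]; linarith
  rw [Real.arctan_neg] at this
  linarith

end Angles

/-! ### Eigenvectors of a definite Hermitian pair -/

section DefinitePair

variable {ι : Type*} [Fintype ι] {A B : Matrix ι ι ℂ}

theorem pairEigenvector_orthogonal (hA : A.IsHermitian) (hB : B.IsHermitian) {E F : ℝ}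
    (hEF : E ≠ F) {x y : ι → ℂ} (hx : A *ᵥ x = (E : ℂ) • (B *ᵥ x))
    (hy : A *ᵥ y = (F : ℂ) • (B *ᵥ y)) : star x ⬝ᵥ (B *ᵥ y) = 0 := by
  have h := star_dotProduct_mulVec_comm hA x y
  rw [hx, hy, dotProduct_smul, dotProduct_smul, star_smul, ← star_dotProduct_mulVec_comm hB] at h
  simp only [smul_eq_mul, Complex.star_def, Complex.conj_ofReal] at h
  have h' : ((F : ℂ) - E) * (star x ⬝ᵥ (B *ᵥ y)) = 0 := by linear_combination h
  refine (mul_eq_zero.mp h').resolve_left ?_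
  rw [← Complex.ofReal_sub]
  exact_mod_cast sub_ne_zero.mpr hEF.symm

theorem star_sum_dotProduct_mulVec_sum {q : ℕ} (M : Matrix ι ι ℂ) (x : Fin q → ι → ℂ)
    (c : Fin q → ℂ) :
    star (∑ j, c j • x j) ⬝ᵥ (M *ᵥ ∑ j, c j • x j) =
      ∑ i, ∑ j, star (c i) * c j * (star (x i) ⬝ᵥ (M *ᵥ x j)) := by
  simp only [star_sum, star_smul, sum_dotProduct, smul_dotProduct, smul_eq_mul,
    Matrix.mulVec_sum, dotProduct_sum, mulVec_smul, dotProduct_smul, Finset.mul_sum, mul_assoc]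
  rw [Finset.sum_comm]
  exact Finset.sum_congr rfl fun i _ => Finset.sum_congr rfl fun j _ => by ring

/-- On the span of eigenvectors with eigenvalues at least `t`, the Rayleigh quotient is at least
`t`. -/
theorem mul_quadForm_le_of_sum (hA : A.IsHermitian) (hB : B.PosSemidef) {q : ℕ}
    {x : Fin q → ι → ℂ} {E : Fin q → ℝ} (hx : ∀ j, A *ᵥ x j = (E j : ℂ) • (B *ᵥ x j)) {t : ℝ}
    (c : Fin q → ℂ) (hc : ∀ j, c j ≠ 0 → t ≤ E j) :
    t * quadForm B (∑ j, c j • x j) ≤ quadForm A (∑ j, c j • x j) := by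
  -- On the span, the form of `A - t B` is the form of `B` at `w`. Cross terms with distinct
  -- eigenvalues vanish by orthogonality, and those with equal eigenvalues have equal roots, so no
  -- orthogonalization inside eigenspaces is needed.
  set w : ι → ℂ := ∑ j, (c j * (√(E j - t) : ℂ)) • x j with hw
  have hid : star (∑ j, c j • x j) ⬝ᵥ (A *ᵥ ∑ j, c j • x j) -
      (t : ℂ) * (star (∑ j, c j • x j) ⬝ᵥ (B *ᵥ ∑ j, c j • x j)) = star w ⬝ᵥ (B *ᵥ w) := by
    rw [hw, star_sum_dotProduct_mulVec_sum, star_sum_dotProduct_mulVec_sum,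
      star_sum_dotProduct_mulVec_sum, Finset.mul_sum, ← Finset.sum_sub_distrib]
    refine Finset.sum_congr rfl fun i _ => ?_
    rw [Finset.mul_sum, ← Finset.sum_sub_distrib]
    refine Finset.sum_congr rfl fun j _ => ?_
    rw [hx j, dotProduct_smul, smul_eq_mul]
    by_cases hj : c j = 0
    · simp [hj]
    by_cases hij : E i = E j
    · have hr : (√(E j - t) : ℂ) * (√(E j - t) : ℂ) = (E j : ℂ) - t := by
        rw [← Complex.ofReal_mul, Real.mul_self_sqrt (sub_nonneg.mpr (hc j hj)),
          Complex.ofReal_sub]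
      rw [hij, star_mul']
      simp only [Complex.star_def, Complex.conj_ofReal]
      linear_combination (-(starRingEnd ℂ (c i)) * c j * (star (x i) ⬝ᵥ (B *ᵥ x j))) * hr
    · rw [pairEigenvector_orthogonal hA hB.isHermitian hij (hx i) (hx j)]
      ring
  have h0 : 0 ≤ (star w ⬝ᵥ (B *ᵥ w)).re :=
    (Complex.le_def.mp (hB.dotProduct_mulVec_nonneg w)).1
  rw [← hid, Complex.sub_re, Complex.re_ofReal_mul] at h0
  unfold quadForm
  linarith

theorem quadForm_add_of_orthogonal {M : Matrix ι ι ℂ} (hM : M.IsHermitian) {x y : ι → ℂ}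
    (h : star x ⬝ᵥ (M *ᵥ y) = 0) : quadForm M (x + y) = quadForm M x + quadForm M y := by
  have h' : star y ⬝ᵥ (M *ᵥ x) = 0 := by
    rw [star_dotProduct_mulVec_comm hM, h, star_zero]
  simp only [quadForm, star_add, mulVec_add, dotProduct_add, add_dotProduct, h, h',
    Complex.add_re, Complex.zero_re]
  ring

/-- Decomposition of a vector along an eigenvector `x₀` and the span of the eigenvectors with
larger eigenvalues. -/
theorem exists_eigenvector_split (hA : A.IsHermitian) (hB : B.PosDef) {q : ℕ}
    (x : Module.Basis (Fin q) ℂ (ι → ℂ)) {E : Fin q → ℝ}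
    (hx : ∀ j, IsPairEigenvector A B (E j) (x j)) {E₀ t : ℝ} {x₀ : ι → ℂ}
    (hx₀ : IsPairEigenvector A B E₀ x₀) (j₀ : Fin q) (ht : E₀ < t) (htE : ∀ j, j ≠ j₀ → t ≤ E j)
    (y : ι → ℂ) :
    ∃ (c : ℂ) (z : ι → ℂ), y = c • x₀ + z ∧
      quadForm A y = ‖c‖ ^ 2 * quadForm A x₀ + quadForm A z ∧
      quadForm B y = ‖c‖ ^ 2 * quadForm B x₀ + quadForm B z ∧
      t * quadForm B z ≤ quadForm A z ∧ ((∀ j, j = j₀) → z = 0) := by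
  -- The vector `x₀` need not be `x j₀`. Without a component along it, `x₀` would lie in the span of
  -- eigenvalues at least `t`, and its Rayleigh quotient `E₀ < t` would be too small.
  have hd : x.repr x₀ j₀ ≠ 0 := by
    intro hd
    have h := mul_quadForm_le_of_sum hA hB.posSemidef (fun j => (hx j).2) (t := t)
      (fun j => x.repr x₀ j) fun j hj => htE j fun h => hj (h ▸ hd)
    rw [x.sum_repr, hx₀.quadForm_eq] at h
    have := quadForm_pos hB hx₀.1
    nlinarith
  set c : ℂ := x.repr y j₀ / x.repr x₀ j₀ with hc
  set z : ι → ℂ := y - c • x₀ with hz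
  have hz0 : x.repr z j₀ = 0 := by
    rw [hz, map_sub, map_smul]
    simp [hc, hd]
  have hyz : y = c • x₀ + z := by rw [hz]; abel
  have horth : star x₀ ⬝ᵥ (B *ᵥ z) = 0 := by
    rw [← x.sum_repr z, Matrix.mulVec_sum, dotProduct_sum]
    refine Finset.sum_eq_zero fun j _ => ?_
    rw [mulVec_smul, dotProduct_smul]
    by_cases hj : j = j₀
    · rw [hj, hz0, zero_smul]
    · rw [pairEigenvector_orthogonal hA hB.isHermitian (ht.trans_le (htE j hj)).ne hx₀.2 (hx j).2,
        smul_zero]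
  have horthA : star x₀ ⬝ᵥ (A *ᵥ z) = 0 := by
    rw [star_dotProduct_mulVec_comm hA, hx₀.2, dotProduct_smul, star_smul,
      ← star_dotProduct_mulVec_comm hB.isHermitian, horth, smul_zero]
  refine ⟨c, z, hyz, ?_, ?_, ?_, ?_⟩
  · rw [hyz, quadForm_add_of_orthogonal hA, quadForm_smul]
    rw [star_smul, smul_dotProduct, horthA, smul_zero]
  · rw [hyz, quadForm_add_of_orthogonal hB.isHermitian, quadForm_smul]
    rw [star_smul, smul_dotProduct, horth, smul_zero]
  · have h := mul_quadForm_le_of_sum hA hB.posSemidef (fun j => (hx j).2) (t := t)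
      (fun j => x.repr z j) fun j hj => htE j fun h => hj (h ▸ hz0)
    rwa [x.sum_repr] at h
  · intro h
    rw [← x.sum_repr z]
    exact Finset.sum_eq_zero fun j _ => by rw [h j, hz0, zero_smul]

theorem eigenangleDist_eq (hA : A.IsHermitian) (hB : B.IsHermitian) (x : ι → ℂ) :
    eigenangleDist A B x = √(quadForm A x ^ 2 + quadForm B x ^ 2) := by
  rw [eigenangleDist, add_mulVec, smul_mulVec, dotProduct_add, dotProduct_smul,
    ← coe_quadForm hA, ← coe_quadForm hB, smul_eq_mul, mul_comm, Complex.norm_add_mul_I]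

end DefinitePair

/-! ### Perturbation of the least eigenangle -/

section Perturbation

variable {ι : Type*} [Fintype ι] [DecidableEq ι] {A B A' B' : Matrix ι ι ℂ} {χ : ℝ}

/-- Cauchy–Schwarz in the plane: the two form differences are paired with the unit vector `(cos ψ,
-sin ψ)`, which is why `χ` bounds the root of the sum of squares. -/
theorem abs_rotated_quadForm_sub_le (hχ : √(‖A' - A‖ ^ 2 + ‖B' - B‖ ^ 2) ≤ χ) (ψ : ℝ)
    (y : ι → ℂ) :
    |(quadForm A' y * Real.cos ψ - quadForm B' y * Real.sin ψ) -
      (quadForm A y * Real.cos ψ - quadForm B y * Real.sin ψ)| ≤ χ * sqNorm y := by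
  have hχ0 : 0 ≤ χ := (Real.sqrt_nonneg _).trans hχ
  have hsq : ‖A' - A‖ ^ 2 + ‖B' - B‖ ^ 2 ≤ χ ^ 2 := Real.sqrt_le_left hχ0 |>.mp hχ
  have hS := sqNorm_nonneg y
  have hu := abs_quadForm_le (A' - A) y
  have hv := abs_quadForm_le (B' - B) y
  rw [quadForm_sub] at hu hv
  set u := quadForm A' y - quadForm A y
  set v := quadForm B' y - quadForm B y
  have hu2 : u ^ 2 ≤ (‖A' - A‖ * sqNorm y) ^ 2 := sq_le_sq' (abs_le.mp hu).1 (abs_le.mp hu).2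
  have hv2 : v ^ 2 ≤ (‖B' - B‖ * sqNorm y) ^ 2 := sq_le_sq' (abs_le.mp hv).1 (abs_le.mp hv).2
  have huv : u ^ 2 + v ^ 2 ≤ (χ * sqNorm y) ^ 2 := by
    have := mul_le_mul_of_nonneg_right hsq (sq_nonneg (sqNorm y))
    linarith [mul_pow ‖A' - A‖ (sqNorm y) 2, mul_pow ‖B' - B‖ (sqNorm y) 2,
      mul_pow χ (sqNorm y) 2, add_mul (‖A' - A‖ ^ 2) (‖B' - B‖ ^ 2) (sqNorm y ^ 2)]
  refine abs_le_of_sq_le_sq ?_ (by positivity)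
  have hid : (u * Real.cos ψ - v * Real.sin ψ) ^ 2 + (u * Real.sin ψ + v * Real.cos ψ) ^ 2 =
      u ^ 2 + v ^ 2 := by
    linear_combination (u ^ 2 + v ^ 2) * Real.sin_sq_add_cos_sq ψ
  have heq : (quadForm A' y * Real.cos ψ - quadForm B' y * Real.sin ψ) -
      (quadForm A y * Real.cos ψ - quadForm B y * Real.sin ψ) =
      u * Real.cos ψ - v * Real.sin ψ := by simp only [u, v]; ring
  rw [heq]
  nlinarith [sq_nonneg (u * Real.sin ψ + v * Real.cos ψ)]

/-- Perturbation of the least eigenangle of a definite pair under a gap condition. -/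
theorem abs_arctan_sub_arctan_le (hA : A.IsHermitian) (hB : B.PosDef) (hB' : B'.PosDef)
    {ε : ℝ} (hε : 0 < ε) (hBε : ∀ y, ε * sqNorm y ≤ quadForm B y)
    (hχ : √(‖A' - A‖ ^ 2 + ‖B' - B‖ ^ 2) ≤ χ) {m n : ℕ} (hm : 0 < m) (hmn : m ≤ n)
    {E : Fin m → ℝ} (hE : IsEigenvalueSequence A B E) {x₀ : ι → ℂ}
    (hx₀ : IsPairEigenvector A B (E ⟨0, hm⟩) x₀) (hx₀1 : sqNorm x₀ = 1) (hnχ : n * χ ≤ ε)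
    (hgap : ∀ j : Fin m, j.val = 1 →
      Real.arcsin (n * χ / ε) ≤ Real.arctan (E j) - Real.arctan (E ⟨0, hm⟩))
    {F : ℝ} {w : ι → ℂ} (hw : IsPairEigenvector A' B' F w)
    (hF : ∀ y, F * quadForm B' y ≤ quadForm A' y) :
    |Real.arctan (E ⟨0, hm⟩) - Real.arctan F| ≤ Real.arcsin (n * χ / eigenangleDist A B x₀) := by
  obtain ⟨hmono, x, hx⟩ := hE
  set E₀ := E ⟨0, hm⟩ with hE₀
  have hχ0 : 0 ≤ χ := (Real.sqrt_nonneg _).trans hχ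
  have hn1 : (1 : ℝ) ≤ n := by exact_mod_cast hm.trans_le hmn
  have hs0 : 0 ≤ n * χ := by positivity
  have hχs : χ ≤ n * χ := le_mul_of_one_le_left hχ0 hn1
  set b := quadForm B x₀ with hb
  have hbε : ε ≤ b := by simpa [hx₀1] using hBε x₀
  have hb0 : 0 < b := hε.trans_le hbε
  have ha : quadForm A x₀ = E₀ * b := hx₀.quadForm_eq
  rw [eigenangleDist_eq hA hB.isHermitian, ha]
  set d := √((E₀ * b) ^ 2 + b ^ 2) with hd
  have hbd : b ≤ d := Real.le_sqrt_of_sq_le (by nlinarith [sq_nonneg (E₀ * b)])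
  have hd0 : 0 < d := hb0.trans_le hbd
  set φ := Real.arcsin (n * χ / d) with hφ
  have hφ0 : 0 ≤ φ := Real.arcsin_nonneg.mpr (by positivity)
  have hsinφ : d * Real.sin φ = n * χ := by
    rw [hφ, Real.sin_arcsin (by linarith [div_nonneg hs0 hd0.le])
      ((div_le_one hd0).mpr (by linarith)), mul_div_cancel₀ _ hd0.ne']
  have hθlt := Real.arctan_lt_pi_div_two E₀
  have hθgt := Real.neg_pi_div_two_lt_arctan E₀
  have hrot := fun ψ => mul_cos_sub_mul_sin hb0 E₀ ψ
  have hupper : Real.arctan F ≤ Real.arctan E₀ + φ := by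
    -- At this angle the unperturbed form at `x₀` is `-n χ ≤ -χ`, so the perturbed one is
    -- nonpositive there.
    refine arctan_le_of_nonpos (by linarith) fun hlt => ?_
    have hcos := Real.cos_pos_of_mem_Ioo
      ⟨(by linarith : -(Real.pi / 2) < Real.arctan E₀ + φ), hlt⟩
    have h1 := abs_le.mp (abs_rotated_quadForm_sub_le hχ (Real.arctan E₀ + φ) x₀)
    have h2 := hrot (Real.arctan E₀ + φ)
    rw [sub_add_cancel_left, Real.sin_neg, mul_neg, hsinφ] at h2
    rw [hx₀1, ha, ← hb, h2] at h1
    have hb'0 := quadForm_pos hB' hx₀.1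
    have h3 := mul_le_mul_of_nonneg_right (hF x₀) hcos.le
    by_contra! hpos
    nlinarith [mul_pos hpos hb'0]
  have hlower : Real.arctan E₀ - φ ≤ Real.arctan F := by
    refine le_arctan_of_nonneg (by linarith) fun hlt => ?_
    set ψ := Real.arctan E₀ - φ with hψ
    have hcos := Real.cos_pos_of_mem_Ioo ⟨hlt, (by linarith : ψ < Real.pi / 2)⟩
    have hform : χ * sqNorm w ≤ quadForm A w * Real.cos ψ - quadForm B w * Real.sin ψ := by
      have hrot0 := hrot ψ
      rw [hψ, sub_sub_cancel, hsinφ, ← hψ] at hrot0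
      -- If `χ = 0` the gap hypothesis does not separate `E₀` from the next eigenvalue, so no
      -- splitting is available; then `φ = 0` and the Rayleigh bound suffices.
      rcases hχ0.eq_or_lt with hχz | hχpos
      · have h := mul_quadForm_le_of_sum hA hB.posSemidef (fun j => (hx j).2) (t := E₀)
          (fun j => x.repr w j) fun j _ => hmono (Fin.mk_le_of_le_val (Nat.zero_le _))
        rw [x.sum_repr] at h
        rw [← hχz, mul_zero] at hrot0
        have htan : E₀ * Real.cos ψ = Real.sin ψ := by
          have : b * (E₀ * Real.cos ψ - Real.sin ψ) = 0 := by linarith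
          linarith [(mul_eq_zero.mp this).resolve_left hb0.ne']
        rw [← hχz, ← htan]
        nlinarith [mul_le_mul_of_nonneg_right h hcos.le]
      · have hspos : 0 < n * χ := hχpos.trans_le hχs
        have hmain : ∀ t, E₀ < t → (∀ j : Fin m, j ≠ ⟨0, hm⟩ → t ≤ E j) →
            n * χ ≤ ε * (t * Real.cos ψ - Real.sin ψ) →
            χ * sqNorm w ≤ quadForm A w * Real.cos ψ - quadForm B w * Real.sin ψ := by
          intro t ht htE htb
          obtain ⟨c, z, hwz, hAw, hBw, hz, hz0⟩ :=
            exists_eigenvector_split hA hB x hx hx₀ ⟨0, hm⟩ ht htE w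
          have hzB := hBε z
          have hzn := sqNorm_nonneg z
          have h1 : n * χ * sqNorm z ≤ (t * Real.cos ψ - Real.sin ψ) * quadForm B z := by
            have ht0 : 0 ≤ t * Real.cos ψ - Real.sin ψ :=
              (pos_of_mul_pos_right (hspos.trans_le htb) hε.le).le
            calc n * χ * sqNorm z ≤ ε * (t * Real.cos ψ - Real.sin ψ) * sqNorm z := by gcongr
              _ = (t * Real.cos ψ - Real.sin ψ) * (ε * sqNorm z) := by ring
              _ ≤ _ := by gcongr
          have h2 : n * χ * (‖c‖ ^ 2 + sqNorm z) ≤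
              quadForm A w * Real.cos ψ - quadForm B w * Real.sin ψ := by
            rw [hAw, hBw, ha, ← hb]
            have h3 := mul_le_mul_of_nonneg_right hz hcos.le
            have h4 : ‖c‖ ^ 2 * (E₀ * b * Real.cos ψ - b * Real.sin ψ) = ‖c‖ ^ 2 * (n * χ) := by
              rw [hrot0]
            linarith
          refine le_trans ?_ h2
          have hcx : sqNorm (c • x₀) = ‖c‖ ^ 2 := by rw [sqNorm_smul, hx₀1, mul_one]
          rcases Nat.lt_or_ge m 2 with hm2 | hm2
          · have hz' : z = 0 := hz0 fun j => Fin.ext (by have := j.2; simp; omega)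
            rw [hwz, hz', add_zero, hcx]
            have : sqNorm (0 : ι → ℂ) = 0 := by simp [sqNorm]
            rw [this, add_zero]
            gcongr
          · have hn2 : (2 : ℝ) ≤ n := by exact_mod_cast hm2.trans hmn
            have h5 := sqNorm_add_le (c • x₀) z
            rw [← hwz, hcx] at h5
            calc χ * sqNorm w ≤ χ * (2 * (‖c‖ ^ 2 + sqNorm z)) := by gcongr
              _ ≤ χ * (n * (‖c‖ ^ 2 + sqNorm z)) := by gcongr
              _ = _ := by ring
        rcases Nat.lt_or_ge m 2 with hm2 | hm2
        -- With a single eigenvalue nothing lies above `E₀`, and `t` may be taken as large as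
        -- needed.
        · obtain ⟨t, ht1, ht2⟩ : ∃ t, E₀ < t ∧ n * χ ≤ ε * (t * Real.cos ψ - Real.sin ψ) := by
            refine ⟨max (E₀ + 1) ((n * χ / ε + Real.sin ψ) / Real.cos ψ),
              (lt_add_one E₀).trans_le (le_max_left _ _), ?_⟩
            rw [← div_le_iff₀' hε, le_sub_iff_add_le, ← div_le_iff₀ hcos]
            exact le_max_right _ _
          exact hmain t ht1 (fun j hj => absurd (Fin.ext (by have := j.2; simp; omega)) hj) ht2
        · have hg := hgap ⟨1, hm2⟩ rfl
          have hpos : 0 < Real.arcsin (n * χ / ε) := Real.arcsin_pos.mpr (by positivity)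
          refine hmain (E ⟨1, hm2⟩) (Real.arctan_strictMono.lt_iff_lt.mp (by linarith)) ?_
            (le_mul_cos_sub_sin_of_arcsin_le hε hs0 hnχ hlt (by linarith) hg)
          intro j hj
          refine hmono (Fin.mk_le_of_le_val ?_)
          exact Nat.one_le_iff_ne_zero.mpr fun h => hj (Fin.ext h)
    have h1 := abs_le.mp (abs_rotated_quadForm_sub_le hχ ψ w)
    have hb' := quadForm_pos hB' hw.1
    rw [hw.quadForm_eq] at h1
    have h2 : 0 ≤ (F * Real.cos ψ - Real.sin ψ) * quadForm B' w := by linarith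
    exact nonneg_of_mul_nonneg_left h2 hb'
  rw [abs_le]
  constructor <;> linarith

end Perturbation

/-! ### Matrices with orthonormal columns -/

section Isometry

variable {ι κ : Type*} [Fintype ι] [Fintype κ] [DecidableEq κ]

theorem norm_le_one_of_conjTranspose_mul_self {C : Matrix ι κ ℂ} (h : Cᴴ * C = 1) : ‖C‖ ≤ 1 := by
  have h1 := l2_opNorm_conjTranspose_mul_self C
  have h2 : ‖(1 : Matrix κ κ ℂ)‖ ≤ 1 := by
    rw [← diagonal_one, l2_opNorm_diagonal]
    exact (pi_norm_le_iff_of_nonneg zero_le_one).mpr fun i => by simp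
  rw [h] at h1
  nlinarith [norm_nonneg C]

theorem sqNorm_mulVec_of_conjTranspose_mul_self {C : Matrix ι κ ℂ} (h : Cᴴ * C = 1) (x : κ → ℂ) :
    sqNorm (C *ᵥ x) = sqNorm x := by
  have : star (C *ᵥ x) ⬝ᵥ (C *ᵥ x) = star x ⬝ᵥ x := by
    rw [star_mulVec, ← dotProduct_mulVec, mulVec_mulVec, h, one_mulVec]
  rw [star_dotProduct_self, star_dotProduct_self] at this
  exact_mod_cast this

end Isometry

/-! ### Congruence of pairs and compressions -/

section Congruence

variable {ι κ : Type*} [Fintype ι] [DecidableEq ι] [Fintype κ] [DecidableEq κ]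
  {A B : Matrix ι ι ℂ} {A' B' : Matrix κ κ ℂ}

theorem StarCongruent.symm (h : StarCongruent A B A' B') : StarCongruent A' B' A B := by
  obtain ⟨W, W', h1, h2, rfl, rfl⟩ := h
  have h3 : W'ᴴ * Wᴴ = 1 := by rw [← conjTranspose_mul, h1, conjTranspose_one]
  have key : ∀ M : Matrix ι ι ℂ, M = W'ᴴ * (Wᴴ * M * W) * W' := fun M => by
    calc M = (W'ᴴ * Wᴴ) * M * (W * W') := by rw [h3, h1, Matrix.one_mul, Matrix.mul_one]
      _ = _ := by simp only [Matrix.mul_assoc]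
  exact ⟨W', W, h2, h1, key A, key B⟩

theorem isPairEigenvector_of_congruent {W : Matrix ι κ ℂ} {W' : Matrix κ ι ℂ} (h1 : W * W' = 1)
    (h2 : W' * W = 1) {E : ℝ} {x : κ → ℂ}
    (hx : IsPairEigenvector (Wᴴ * A * W) (Wᴴ * B * W) E x) :
    IsPairEigenvector A B E (W *ᵥ x) := by
  have h3 : W'ᴴ * Wᴴ = 1 := by rw [← conjTranspose_mul, h1, conjTranspose_one]
  refine ⟨fun h => hx.1 ?_, ?_⟩
  · rw [← one_mulVec x, ← h2, ← mulVec_mulVec, h, mulVec_zero]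
  · have h := congrArg (W'ᴴ *ᵥ ·) hx.2
    simpa only [mulVec_smul, mulVec_mulVec, ← Matrix.mul_assoc, h3, Matrix.one_mul] using h

theorem StarCongruent.isEigenvalueSequence (h : StarCongruent A B A' B') {q : ℕ} {E : Fin q → ℝ}
    (hE : IsEigenvalueSequence A' B' E) : IsEigenvalueSequence A B E := by
  obtain ⟨W, W', h1, h2, rfl, rfl⟩ := h
  obtain ⟨hmono, x, hx⟩ := hE
  refine ⟨hmono, x.map (Matrix.toLin'OfInv h1 h2).symm, fun j => ?_⟩
  rw [Module.Basis.map_apply]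
  exact isPairEigenvector_of_congruent h1 h2 (hx j)

theorem StarCongruent.pairEigenvalues_subset (h : StarCongruent A B A' B') :
    pairEigenvalues A' B' ⊆ pairEigenvalues A B := by
  obtain ⟨W, W', h1, h2, rfl, rfl⟩ := h
  rintro E ⟨x, hx⟩
  exact ⟨_, isPairEigenvector_of_congruent h1 h2 hx⟩

/-- A rectangular matrix that is injective together with its conjugate transpose has a two-sided
inverse. -/
theorem exists_inverse_of_injective (W : Matrix ι κ ℂ) (h1 : ∀ x, W *ᵥ x = 0 → x = 0)
    (h2 : ∀ x, Wᴴ *ᵥ x = 0 → x = 0) : ∃ W' : Matrix κ ι ℂ, W * W' = 1 ∧ W' * W = 1 := by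
  have u1 : IsUnit (Wᴴ * W) := by
    refine mulVec_injective_iff_isUnit.mp ?_
    refine (injective_iff_map_eq_zero (Wᴴ * W).mulVecLin).mpr fun x hx => h1 x ?_
    exact (conjTranspose_mul_self_mulVec_eq_zero W x).mp hx
  have u2 : IsUnit (W * Wᴴ) := by
    refine mulVec_injective_iff_isUnit.mp ?_
    refine (injective_iff_map_eq_zero (W * Wᴴ).mulVecLin).mpr fun x hx => h2 x ?_
    exact (self_mul_conjTranspose_mulVec_eq_zero W x).mp hx
  have hl : (Wᴴ * W)⁻¹ * Wᴴ * W = 1 := by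
    rw [Matrix.mul_assoc, nonsing_inv_mul _ ((isUnit_iff_isUnit_det _).mp u1)]
  have hr : W * (Wᴴ * (W * Wᴴ)⁻¹) = 1 := by
    rw [← Matrix.mul_assoc, mul_nonsing_inv _ ((isUnit_iff_isUnit_det _).mp u2)]
  refine ⟨Wᴴ * (W * Wᴴ)⁻¹, hr, ?_⟩
  have : Wᴴ * (W * Wᴴ)⁻¹ = (Wᴴ * W)⁻¹ * Wᴴ := by
    calc Wᴴ * (W * Wᴴ)⁻¹ = ((Wᴴ * W)⁻¹ * Wᴴ * W) * (Wᴴ * (W * Wᴴ)⁻¹) := by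
          rw [hl, Matrix.one_mul]
      _ = (Wᴴ * W)⁻¹ * Wᴴ * (W * (Wᴴ * (W * Wᴴ)⁻¹)) := by rw [Matrix.mul_assoc]
      _ = _ := by rw [hr, Matrix.mul_one]
  rw [this, hl]

theorem norm_conjTranspose_mul_mul_le {C D : Matrix ι κ ℂ} (hC : ‖C‖ ≤ 1) (hD : ‖D‖ ≤ 1)
    (M : Matrix ι ι ℂ) : ‖Cᴴ * M * D‖ ≤ ‖M‖ := by
  calc ‖Cᴴ * M * D‖ ≤ ‖Cᴴ‖ * ‖M‖ * ‖D‖ :=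
        (l2_opNorm_mul _ _).trans (by gcongr; exact l2_opNorm_mul _ _)
    _ ≤ 1 * ‖M‖ * 1 := by rw [l2_opNorm_conjTranspose]; gcongr
    _ = ‖M‖ := by ring

theorem quadForm_diagonal (d : ι → ℝ) (x : ι → ℂ) :
    quadForm (diagonal fun i => (d i : ℂ)) x = ∑ i, d i * ‖x i‖ ^ 2 := by
  have : star x ⬝ᵥ ((diagonal fun i => (d i : ℂ)) *ᵥ x) = ((∑ i, d i * ‖x i‖ ^ 2 : ℝ) : ℂ) := by
    simp only [dotProduct, mulVec_diagonal, Complex.ofReal_sum, Complex.ofReal_mul,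
      Complex.ofReal_pow, ← Complex.conj_mul', Pi.star_apply, Complex.star_def]
    exact Finset.sum_congr rfl fun i _ => by ring
  rw [quadForm, this, Complex.ofReal_re]

end Congruence

/-! ### Compression to the kept eigenvectors -/

section Eigendecomposition

variable {n : ℕ} {S V : Matrix (Fin n) (Fin n) ℂ} {lam : Fin n → ℝ} {ε : ℝ}

theorem IsEigendecomposition.conjTranspose_mul (h : IsEigendecomposition S V lam) :
    Vᴴ * V = 1 := mem_unitaryGroup_iff'.mp h.unitary

theorem IsEigendecomposition.mul_conjTranspose (h : IsEigendecomposition S V lam) :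
    V * Vᴴ = 1 := mem_unitaryGroup_iff.mp h.unitary

theorem IsEigendecomposition.diagonalize (h : IsEigendecomposition S V lam) :
    Vᴴ * S * V = diagonal fun i => (lam i : ℂ) := by
  rw [Matrix.mul_assoc, h.eigen, ← Matrix.mul_assoc, h.conjTranspose_mul, Matrix.one_mul]

theorem thresholded_eq_submatrix (M V : Matrix (Fin n) (Fin n) ℂ) (lam : Fin n → ℝ) (ε : ℝ) :
    thresholded M V lam ε = (Vᴴ * M * V).submatrix Subtype.val Subtype.val := rfl

theorem IsEigendecomposition.thresholded_eq (h : IsEigendecomposition S V lam) :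
    thresholded S V lam ε = diagonal fun i : Kept lam ε => (lam i : ℂ) := by
  rw [thresholded_eq_submatrix, h.diagonalize, submatrix_diagonal _ _ Subtype.val_injective]
  rfl

theorem IsEigendecomposition.keptColumns_isometry (h : IsEigendecomposition S V lam) :
    (keptColumns V lam ε)ᴴ * keptColumns V lam ε = 1 := by
  have : (keptColumns V lam ε)ᴴ * keptColumns V lam ε =
      (Vᴴ * V).submatrix Subtype.val Subtype.val := rfl
  rw [this, h.conjTranspose_mul, submatrix_one _ Subtype.val_injective]

theorem IsEigendecomposition.quadForm_keptColumns (h : IsEigendecomposition S V lam)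
    (y : Kept lam ε → ℂ) :
    quadForm S (keptColumns V lam ε *ᵥ y) = ∑ i : Kept lam ε, lam i * ‖y i‖ ^ 2 := by
  rw [← quadForm_conjTranspose_mul_mul, ← quadForm_diagonal (fun i : Kept lam ε => lam i),
    ← h.thresholded_eq]
  rfl

/-- On vectors orthogonal to the kept eigenvectors, the form of `S` is bounded by any bound on the
discarded eigenvalues. -/
theorem IsEigendecomposition.quadForm_le_of_orthogonal (h : IsEigendecomposition S V lam) {c : ℝ}
    (hc : ∀ i, ¬ ε < lam i → lam i ≤ c) {x : Fin n → ℂ}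
    (hx : (keptColumns V lam ε)ᴴ *ᵥ x = 0) : quadForm S x ≤ c * sqNorm x := by
  set u := Vᴴ *ᵥ x with hu
  have hxu : x = V *ᵥ u := by rw [hu, mulVec_mulVec, h.mul_conjTranspose, one_mulVec]
  have hu0 : ∀ i, ε < lam i → u i = 0 := fun i hi => congrFun hx ⟨i, hi⟩
  rw [hxu, ← quadForm_conjTranspose_mul_mul, h.diagonalize, quadForm_diagonal,
    sqNorm_mulVec_of_conjTranspose_mul_self h.conjTranspose_mul, sqNorm, Finset.mul_sum]
  refine Finset.sum_le_sum fun i _ => ?_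
  by_cases hi : ε < lam i
  · simp [hu0 i hi]
  · gcongr; exact hc i hi

theorem IsEigendecomposition.eigenvalue_nonneg (h : IsEigendecomposition S V lam)
    (hS : S.PosSemidef) (i : Fin n) : 0 ≤ lam i := by
  have h1 := (hS.conjTranspose_mul_mul_same V).diag_nonneg (i := i)
  rw [h.diagonalize, diagonal_apply_eq] at h1
  exact_mod_cast h1

theorem IsEigendecomposition.norm_le_one (h : IsEigendecomposition S V lam) : ‖V‖ ≤ 1 :=
  norm_le_one_of_conjTranspose_mul_self h.conjTranspose_mul

theorem IsEigendecomposition.eigenvalue_le_norm (h : IsEigendecomposition S V lam) (i : Fin n) :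
    lam i ≤ ‖S‖ := by
  have h1 := norm_conjTranspose_mul_mul_le h.norm_le_one h.norm_le_one S
  rw [h.diagonalize, l2_opNorm_diagonal] at h1
  have h2 := norm_le_pi_norm (fun i => (lam i : ℂ)) i
  rw [Complex.norm_real] at h2
  exact (le_abs_self _).trans (h2.trans h1)

end Eigendecomposition

/-! ### Leakage of eigenvectors out of the noisy kept space -/

section Leakage

variable {n : ℕ} {S ΔS V Vt : Matrix (Fin n) (Fin n) ℂ} {lam lamt : Fin n → ℝ} {ε : ℝ}

/-- The norm of the component of the `i`-th row of `U` in the discarded columns. With `U = Vᴴ Ṽ`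
this is the norm of the component of `v_i` outside the span of the kept columns of `Ṽ`. -/
noncomputable def leakage (U : Matrix (Fin n) (Fin n) ℂ) (lamt : Fin n → ℝ) (ε : ℝ)
    (i : Fin n) : ℝ :=
  √(∑ k, (if ε < lamt k then 0 else ‖U i k‖) ^ 2)

/-- The indicator of the discarded indices, as a diagonal matrix. -/
noncomputable def discardMatrix (lamt : Fin n → ℝ) (ε : ℝ) : Matrix (Fin n) (Fin n) ℂ :=
  diagonal fun k => if ε < lamt k then 0 else 1

theorem leakage_nonneg (U : Matrix (Fin n) (Fin n) ℂ) (lamt : Fin n → ℝ) (ε : ℝ) (i : Fin n) :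
    0 ≤ leakage U lamt ε i := Real.sqrt_nonneg _

theorem leakage_le_one {U : Matrix (Fin n) (Fin n) ℂ} (hU : ‖U‖ ≤ 1) (i : Fin n) :
    leakage U lamt ε i ≤ 1 := by
  refine Real.sqrt_le_one.mpr ?_
  calc _ ≤ ∑ k, ‖U i k‖ ^ 2 := by
        refine Finset.sum_le_sum fun k _ => ?_
        split_ifs
        · simp
        · exact le_rfl
    _ ≤ ‖U‖ ^ 2 := sum_norm_sq_row_le U i
    _ ≤ 1 := pow_le_one₀ (norm_nonneg _) hU

/-- The entry is an inner product of two truncated rows of `U`, so Cauchy–Schwarz yields one leakage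
for each index. -/
theorem norm_discard_entry_le (U : Matrix (Fin n) (Fin n) ℂ) (i j : Fin n) :
    ‖(U * discardMatrix lamt ε * Uᴴ) i j‖ ≤ leakage U lamt ε i * leakage U lamt ε j := by
  refine le_trans ?_ (Real.sum_mul_le_sqrt_mul_sqrt _ _ _)
  rw [mul_apply]
  refine (norm_sum_le _ _).trans (Finset.sum_le_sum fun k _ => ?_)
  rw [discardMatrix, mul_diagonal]
  split_ifs <;> simp

/-- Relative form of the Davis–Kahan bound for a single eigenvector. -/
theorem sub_mul_leakage_le (hS : S.IsHermitian) (hV : IsEigendecomposition S V lam)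
    (hVt : IsEigendecomposition (S + ΔS) Vt lamt) {i : Fin n} (hi : ε ≤ lam i) :
    (lam i - ε) * leakage (Vᴴ * Vt) lamt ε i ≤ ‖ΔS‖ := by
  have hleft : Vᴴ * S = (diagonal fun i => (lam i : ℂ)) * Vᴴ := by
    have h := congrArg conjTranspose hV.eigen
    rw [conjTranspose_mul, conjTranspose_mul, hS.eq, diagonal_conjTranspose] at h
    rw [h]
    congr 2
    ext i
    simp
  -- Sylvester equation for `U = Vᴴ Ṽ`: entrywise, the perturbation is `U i k` times the eigenvalue
  -- difference, which is at least `lam i - ε` in size for discarded `k`.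
  have heq : (diagonal fun i => (lam i : ℂ)) * (Vᴴ * Vt) + Vᴴ * ΔS * Vt =
      (Vᴴ * Vt) * diagonal fun i => (lamt i : ℂ) := by
    rw [Matrix.mul_assoc Vᴴ Vt, ← hVt.eigen, ← Matrix.mul_assoc _ Vᴴ Vt, ← hleft]
    simp only [Matrix.mul_add, Matrix.add_mul, Matrix.mul_assoc]
  have hent : ∀ k, (Vᴴ * ΔS * Vt) i k = ((lamt k - lam i : ℝ) : ℂ) * (Vᴴ * Vt) i k := by
    intro k
    have h := congrFun (congrFun heq i) k
    rw [Matrix.add_apply, diagonal_mul, mul_diagonal] at h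
    push_cast
    linear_combination h
  have hsub : 0 ≤ lam i - ε := sub_nonneg.mpr hi
  refine abs_le_of_sq_le_sq' ?_ (norm_nonneg _) |>.2
  rw [mul_pow, leakage, Real.sq_sqrt (Finset.sum_nonneg fun _ _ => sq_nonneg _), Finset.mul_sum]
  calc _ ≤ ∑ k, ‖(Vᴴ * ΔS * Vt) i k‖ ^ 2 := by
        refine Finset.sum_le_sum fun k _ => ?_
        split_ifs with hk
        · simp
        · rw [hent, norm_mul, Complex.norm_real, mul_pow, Real.norm_eq_abs, sq_abs]
          gcongr ?_ * _
          nlinarith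
    _ ≤ ‖Vᴴ * ΔS * Vt‖ ^ 2 := sum_norm_sq_row_le _ i
    _ ≤ ‖ΔS‖ ^ 2 := by
        gcongr
        exact norm_conjTranspose_mul_mul_le hV.norm_le_one hVt.norm_le_one ΔS

theorem leakage_mul_le (hS : S.IsHermitian) (hV : IsEigendecomposition S V lam)
    (hVt : IsEigendecomposition (S + ΔS) Vt lamt) (hε : 0 < ε) {ρ : ℝ} (hρ : 0 < ρ) {i : Fin n}
    (hi : (1 + ρ) * ε ≤ lam i) :
    leakage (Vᴴ * Vt) lamt ε i * lam i ≤ (1 + ρ⁻¹) * ‖ΔS‖ := by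
  have h := sub_mul_leakage_le hS hV hVt (ε := ε) (i := i) (by nlinarith)
  have hl := leakage_nonneg (Vᴴ * Vt) lamt ε i
  have h1 : lam i ≤ (1 + ρ⁻¹) * (lam i - ε) := by
    have h2 : ε ≤ ρ⁻¹ * (lam i - ε) := by
      rw [inv_mul_eq_div, le_div_iff₀ hρ]; linarith
    linarith
  have hρ' : 0 ≤ 1 + ρ⁻¹ := by positivity
  calc _ ≤ leakage (Vᴴ * Vt) lamt ε i * ((1 + ρ⁻¹) * (lam i - ε)) := by gcongr
    _ = (1 + ρ⁻¹) * ((lam i - ε) * leakage (Vᴴ * Vt) lamt ε i) := by ring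
    _ ≤ _ := by gcongr

theorem keptColumns_mul_conjTranspose (Vt : Matrix (Fin n) (Fin n) ℂ) (lamt : Fin n → ℝ) (ε : ℝ) :
    keptColumns Vt lamt ε * (keptColumns Vt lamt ε)ᴴ = Vt * (1 - discardMatrix lamt ε) * Vtᴴ := by
  have hd : 1 - discardMatrix lamt ε = diagonal fun k => if ε < lamt k then (1 : ℂ) else 0 := by
    rw [discardMatrix, ← diagonal_one, diagonal_sub]
    congr 1
    ext k
    split_ifs <;> simp
  ext i j
  rw [hd, mul_apply, mul_apply]
  simp only [mul_diagonal, keptColumns, submatrix_apply, conjTranspose_apply, id]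
  rw [← Finset.sum_subtype (Finset.univ.filter fun k => ε < lamt k) (by simp)
    (fun k => Vt i k * star (Vt j k)), Finset.sum_filter]
  refine Finset.sum_congr rfl fun k _ => ?_
  split_ifs <;> simp

end Leakage

/-! ### Entrywise error of a compression -/

section Compression

variable {n : ℕ}

/-- In each of `q h q`, `q h` and `h q`, the leakage at the summed index controls the entry of `h`
by `T`, and the leakage at an outer index takes `T` to `R`. The double sum in `q h q` gives `n ^ 2`;
three terms give the 3. -/
theorem norm_compression_entry_le {h q : Matrix (Fin n) (Fin n) ℂ} {l : Fin n → ℝ} {T R : ℝ}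
    (hl0 : ∀ i, 0 ≤ l i) (hl1 : ∀ i, l i ≤ 1) (hq : ∀ i j, ‖q i j‖ ≤ l i * l j)
    (hT : ∀ k j, l k * ‖h k j‖ ≤ T) (hT' : ∀ k j, l k * ‖h j k‖ ≤ T) {i j : Fin n}
    (hi : l i * T ≤ R) (hj : l j * T ≤ R) :
    ‖((1 - q) * h * (1 - q) - h) i j‖ ≤ 3 * (n : ℝ) ^ 2 * R := by
  have hT0 : 0 ≤ T := (mul_nonneg (hl0 i) (norm_nonneg _)).trans (hT i i)
  have hR0 : 0 ≤ R := (mul_nonneg (hl0 i) hT0).trans hi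
  have hn : (1 : ℝ) ≤ n := by exact_mod_cast (Nat.zero_le _).trans_lt i.2
  have heq : (1 - q) * h * (1 - q) - h = q * h * q - q * h - h * q := by noncomm_ring
  have h1 : ‖(q * h) i j‖ ≤ n * R := by
    rw [mul_apply]
    refine (norm_sum_le _ _).trans ((Finset.sum_le_card_nsmul _ _ R fun k _ => ?_).trans_eq
      (by simp))
    rw [norm_mul]
    calc _ ≤ l i * l k * ‖h k j‖ := by gcongr; exact hq i k
      _ = l i * (l k * ‖h k j‖) := by ring
      _ ≤ l i * T := mul_le_mul_of_nonneg_left (hT k j) (hl0 i)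
      _ ≤ R := hi
  have h2 : ‖(h * q) i j‖ ≤ n * R := by
    rw [mul_apply]
    refine (norm_sum_le _ _).trans ((Finset.sum_le_card_nsmul _ _ R fun k _ => ?_).trans_eq
      (by simp))
    rw [norm_mul]
    calc _ ≤ ‖h i k‖ * (l k * l j) := by gcongr; exact hq k j
      _ = l j * (l k * ‖h i k‖) := by ring
      _ ≤ l j * T := mul_le_mul_of_nonneg_left (hT' k i) (hl0 j)
      _ ≤ R := hj
  have h3 : ‖(q * h * q) i j‖ ≤ n * (n * R) := by
    rw [mul_apply]
    refine (norm_sum_le _ _).trans ((Finset.sum_le_card_nsmul _ _ (n * R) fun p _ => ?_).trans_eq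
      (by simp))
    rw [mul_apply, Finset.sum_mul]
    refine (norm_sum_le _ _).trans ((Finset.sum_le_card_nsmul _ _ R fun k _ => ?_).trans_eq
      (by simp))
    rw [norm_mul, norm_mul]
    have hlp : l p * l j ≤ 1 := mul_le_one₀ (hl1 p) (hl0 j) (hl1 j)
    have hlp0 : 0 ≤ l p * l j := mul_nonneg (hl0 p) (hl0 j)
    calc _ ≤ (l i * l k) * ‖h k p‖ * (l p * l j) := by
          gcongr
          · exact mul_nonneg (mul_nonneg (hl0 i) (hl0 k)) (norm_nonneg _)
          · exact hq i k
          · exact hq p j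
      _ = l i * (l k * ‖h k p‖) * (l p * l j) := by ring
      _ ≤ l i * T * 1 := by
          gcongr
          · exact mul_nonneg (hl0 i) hT0
          · exact hl0 i
          · exact hT k p
      _ ≤ R := by rw [mul_one]; exact hi
  rw [heq, Matrix.sub_apply, Matrix.sub_apply]
  have h4 := norm_sub_le ((q * h * q) i j - (q * h) i j) ((h * q) i j)
  have h5 := norm_sub_le ((q * h * q) i j) ((q * h) i j)
  have h6 : n * R ≤ n * (n * R) := by
    have : 0 ≤ n * R := by positivity
    nlinarith
  nlinarith

/-- As `l ≤ 1`, only `l ^ (1 - α)` is spent: it joins `a ^ (1 - α)`, where `l * a ≤ ε` applies. -/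
theorem mul_geometricMean_le {l a b L ε α : ℝ} (hl0 : 0 ≤ l) (hl1 : l ≤ 1) (ha : 0 ≤ a)
    (hb : 0 ≤ b) (haL : a ≤ L) (hbL : b ≤ L) (hε : 0 < ε) (hla : l * a ≤ ε) (hα0 : 0 ≤ α)
    (hα1 : α ≤ 1) : l * (min a b ^ (1 - α) * max a b ^ α) ≤ ε * (L / ε) ^ α := by
  have hα' : 0 ≤ 1 - α := by linarith
  have hL : 0 ≤ L := ha.trans haL
  have h1 : l ≤ l ^ (1 - α) := by
    rcases hl0.eq_or_lt with h | h
    · rw [← h]; exact Real.rpow_nonneg le_rfl _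
    · simpa using Real.rpow_le_rpow_of_exponent_ge h hl1 (by linarith : 1 - α ≤ 1)
  calc l * (min a b ^ (1 - α) * max a b ^ α)
      ≤ l ^ (1 - α) * (a ^ (1 - α) * L ^ α) := by
        gcongr
        · exact min_le_left _ _
        · exact max_le haL hbL
    _ = (l * a) ^ (1 - α) * L ^ α := by rw [Real.mul_rpow hl0 ha, mul_assoc]
    _ ≤ ε ^ (1 - α) * L ^ α := by gcongr
    _ = ε * (L / ε) ^ α := by
        rw [Real.div_rpow hL hε.le, Real.rpow_sub hε, Real.rpow_one]; ring

end Compression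

/-! ### The overlap congruence and its error -/

section Thresholding

variable {n : ℕ} {S ΔS V Vt : Matrix (Fin n) (Fin n) ℂ} {lam lamt : Fin n → ℝ}
  {ε ρ α : ℝ} {m : ℕ}

theorem SpectralGap.le_of_kept {η : ℝ} (hgap : SpectralGap lam m η ε ρ) (hlam : Antitone lam)
    (hη : 0 ≤ η) {i : Fin n} (hi : ε < lam i) : (1 + ρ) * ε ≤ lam i := by
  obtain ⟨hm, hmn, hlow, -, hhigh⟩ := hgap
  have him : i.val < m := by
    by_contra! h
    have h1 := hlow ⟨m, h.trans_lt i.2⟩ rfl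
    have h2 : lam i ≤ lam ⟨m, h.trans_lt i.2⟩ := hlam h
    linarith
  have h1 := hhigh ⟨m - 1, by omega⟩ (by simp; omega)
  exact h1.trans (hlam (show i.val ≤ m - 1 by omega))

theorem SpectralGap.add_le_of_discarded {η : ℝ} (hgap : SpectralGap lam m η ε ρ)
    (hlam : Antitone lam) {i : Fin n} (hi : ¬ ε < lam i) : lam i + η ≤ ε := by
  obtain ⟨hm, hmn, hlow, hlt, hhigh⟩ := hgap
  have him : m ≤ i.val := by
    by_contra! h
    have h1 := hhigh ⟨m - 1, by omega⟩ (by simp; omega)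
    have h2 := hlam (show i ≤ ⟨m - 1, by omega⟩ from (by omega : i.val ≤ m - 1))
    linarith
  have h1 := hlow ⟨m, him.trans_lt i.2⟩ rfl
  have h2 : lam i ≤ lam ⟨m, him.trans_lt i.2⟩ := hlam him
  linarith

theorem SpectralGap.nonempty_kept {η : ℝ} (hgap : SpectralGap lam m η ε ρ) :
    Nonempty (Kept lam ε) := by
  obtain ⟨hm, hmn, -, hlt, hhigh⟩ := hgap
  exact ⟨⟨⟨m - 1, by omega⟩, hlt.trans_le (hhigh _ (by simp; omega))⟩⟩

/-- The overlap matrix of the kept columns of `Ṽ` and of `V`. -/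
noncomputable def overlap (V Vt : Matrix (Fin n) (Fin n) ℂ) (lam lamt : Fin n → ℝ) (ε : ℝ) :
    Matrix (Kept lamt ε) (Kept lam ε) ℂ :=
  (keptColumns Vt lamt ε)ᴴ * keptColumns V lam ε

theorem exists_overlap_inverse (hV : IsEigendecomposition S V lam)
    (hVt : IsEigendecomposition (S + ΔS) Vt lamt) (hε : 0 < ε) (hρ : 0 < ρ)
    (hgap : SpectralGap lam m ‖ΔS‖ ε ρ) (hnoise : (1 + ρ⁻¹) * ‖ΔS‖ ≤ ε) :
    ∃ W' : Matrix (Kept lam ε) (Kept lamt ε) ℂ,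
      overlap V Vt lam lamt ε * W' = 1 ∧ W' * overlap V Vt lam lamt ε = 1 := by
  refine exists_inverse_of_injective _ (fun y hy => ?_) (fun y hy => ?_)
  · by_contra hy0
    have hpos := sqNorm_pos hy0
    rw [overlap, ← mulVec_mulVec] at hy
    have h1 := hVt.quadForm_le_of_orthogonal (c := ε) (fun i hi => not_lt.mp hi) hy
    have h2 := hV.quadForm_keptColumns y
    have h3 := (abs_le.mp (abs_quadForm_le ΔS (keptColumns V lam ε *ᵥ y))).1
    rw [sqNorm_mulVec_of_conjTranspose_mul_self hV.keptColumns_isometry] at h1 h3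
    have h4 : (1 + ρ) * ε * sqNorm y ≤ ∑ i : Kept lam ε, lam i * ‖y i‖ ^ 2 := by
      rw [sqNorm, Finset.mul_sum]
      refine Finset.sum_le_sum fun i _ => ?_
      gcongr
      exact hgap.le_of_kept hV.antitone (norm_nonneg _) i.2
    rw [quadForm_add] at h1
    have h5 : (ρ * ε - ‖ΔS‖) * sqNorm y ≤ 0 := by linarith
    have h6 : ρ * ε ≤ ‖ΔS‖ := by
      by_contra! h
      nlinarith
    have h7 : ρ * ((1 + ρ⁻¹) * ‖ΔS‖) = ρ * ‖ΔS‖ + ‖ΔS‖ := by field_simp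
    have h8 := mul_le_mul_of_nonneg_left hnoise hρ.le
    have h9 : 0 < ‖ΔS‖ := (mul_pos hρ hε).trans_le h6
    nlinarith
  · by_contra hy0
    have hpos := sqNorm_pos hy0
    rw [overlap, conjTranspose_mul, conjTranspose_conjTranspose, ← mulVec_mulVec] at hy
    have h1 := hV.quadForm_le_of_orthogonal (c := ε - ‖ΔS‖)
      (fun i hi => by linarith [hgap.add_le_of_discarded hV.antitone hi]) hy
    have h2 := hVt.quadForm_keptColumns y
    have h3 := (abs_le.mp (abs_quadForm_le ΔS (keptColumns Vt lamt ε *ᵥ y))).2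
    rw [sqNorm_mulVec_of_conjTranspose_mul_self hVt.keptColumns_isometry] at h1 h3
    -- Strictness is essential: the opposite bound is exactly `(ε - ‖ΔS‖) + ‖ΔS‖ = ε`.
    have h4 : ε * sqNorm y < ∑ i : Kept lamt ε, lamt i * ‖y i‖ ^ 2 := by
      rw [sqNorm, Finset.mul_sum]
      obtain ⟨k, hk⟩ := Function.ne_iff.mp hy0
      refine Finset.sum_lt_sum (fun i _ => ?_) ⟨k, Finset.mem_univ _, ?_⟩
      · gcongr; exact i.2.le
      · have : 0 < ‖y k‖ := norm_pos_iff.mpr hk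
        gcongr
        exact k.2
    rw [quadForm_add] at h2
    linarith

theorem norm_overlap_le_one (hV : IsEigendecomposition S V lam)
    (hVt : IsEigendecomposition (S + ΔS) Vt lamt) : ‖overlap V Vt lam lamt ε‖ ≤ 1 := by
  have h1 := norm_le_one_of_conjTranspose_mul_self (hV.keptColumns_isometry (ε := ε))
  have h2 := norm_le_one_of_conjTranspose_mul_self (hVt.keptColumns_isometry (ε := ε))
  refine (l2_opNorm_mul _ _).trans ?_
  rw [l2_opNorm_conjTranspose]
  exact mul_le_one₀ h2 (norm_nonneg _) h1

theorem overlap_congruence_eq_submatrix (hV : IsEigendecomposition S V lam)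
    (K : Matrix (Fin n) (Fin n) ℂ) :
    (overlap V Vt lam lamt ε)ᴴ * thresholded K Vt lamt ε * overlap V Vt lam lamt ε =
      ((Vᴴ * (keptColumns Vt lamt ε * (keptColumns Vt lamt ε)ᴴ) * V) * (Vᴴ * K * V) *
        (Vᴴ * (keptColumns Vt lamt ε * (keptColumns Vt lamt ε)ᴴ) * V)).submatrix
        Subtype.val Subtype.val := by
  set C := keptColumns Vt lamt ε with hC
  have h1 : (Vᴴ * (C * Cᴴ) * V) * (Vᴴ * K * V) * (Vᴴ * (C * Cᴴ) * V) =
      Vᴴ * (C * (Cᴴ * K * C) * Cᴴ) * V := by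
    calc _ = Vᴴ * (C * Cᴴ) * (V * Vᴴ) * K * (V * Vᴴ) * (C * Cᴴ) * V := by
          simp only [Matrix.mul_assoc]
      _ = _ := by
          rw [hV.mul_conjTranspose]
          simp only [Matrix.mul_assoc, Matrix.mul_one]
  rw [h1]
  have h2 : (Vᴴ * (C * (Cᴴ * K * C) * Cᴴ) * V).submatrix
      (Subtype.val : Kept lam ε → Fin n) (Subtype.val : Kept lam ε → Fin n) =
      (keptColumns V lam ε)ᴴ * (C * (Cᴴ * K * C) * Cᴴ) * keptColumns V lam ε := rfl
  rw [h2, overlap, thresholded, ← hC, conjTranspose_mul, conjTranspose_conjTranspose]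
  simp only [Matrix.mul_assoc]

theorem compressed_projection_eq (hV : IsEigendecomposition S V lam)
    (hVt : IsEigendecomposition (S + ΔS) Vt lamt) :
    Vᴴ * (keptColumns Vt lamt ε * (keptColumns Vt lamt ε)ᴴ) * V =
      1 - (Vᴴ * Vt) * discardMatrix lamt ε * (Vᴴ * Vt)ᴴ := by
  rw [keptColumns_mul_conjTranspose, Matrix.mul_sub, Matrix.sub_mul, Matrix.mul_one,
    hVt.mul_conjTranspose, Matrix.mul_sub, Matrix.sub_mul, Matrix.mul_one, hV.conjTranspose_mul,
    conjTranspose_mul, conjTranspose_conjTranspose]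
  simp only [Matrix.mul_assoc]

/-- Replacing the kept eigenvectors of `S` by their projections onto the kept eigenvectors of
`S + ΔS` changes the compression of `K` by little. -/
theorem norm_overlap_congruence_sub_le {K : Matrix (Fin n) (Fin n) ℂ} {μ : ℝ}
    (hS : S.PosSemidef) (hV : IsEigendecomposition S V lam)
    (hVt : IsEigendecomposition (S + ΔS) Vt lamt) (hε : 0 < ε) (hμ : 0 < μ) (hα0 : 0 ≤ α)
    (hα : α ≤ 1) (hρ : 0 < ρ) (hgeo : GeometricMeanBound K V lam μ α)
    (hgap : SpectralGap lam m ‖ΔS‖ ε ρ) (hnoise : (1 + ρ⁻¹) * ‖ΔS‖ ≤ ε) :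
    ‖(overlap V Vt lam lamt ε)ᴴ * thresholded K Vt lamt ε * overlap V Vt lam lamt ε -
      thresholded K V lam ε‖ ≤
      3 * μ * (n : ℝ) ^ 3 * (1 + ρ⁻¹) * (‖S‖ / ε) ^ α * ‖ΔS‖ := by
  set l := leakage (Vᴴ * Vt) lamt ε with hl
  set c := (‖S‖ / ε) ^ α with hc
  have hc0 : 0 ≤ c := by positivity
  have hU : ‖Vᴴ * Vt‖ ≤ 1 := by
    refine (l2_opNorm_mul _ _).trans ?_
    rw [l2_opNorm_conjTranspose]
    exact mul_le_one₀ hV.norm_le_one (norm_nonneg _) hVt.norm_le_one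
  have hl0 : ∀ i, 0 ≤ l i := leakage_nonneg _ _ _
  have hl1 : ∀ i, l i ≤ 1 := leakage_le_one hU
  have hlam0 := hV.eigenvalue_nonneg hS
  have hlamS := hV.eigenvalue_le_norm
  have hkept : ∀ i, ε < lam i → l i * lam i ≤ (1 + ρ⁻¹) * ‖ΔS‖ := fun i hi =>
    leakage_mul_le hS.isHermitian hV hVt hε hρ (hgap.le_of_kept hV.antitone (norm_nonneg _) hi)
  have hlε : ∀ i, l i * lam i ≤ ε := by
    intro i
    by_cases hi : ε < lam i
    · exact (hkept i hi).trans hnoise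
    · exact (mul_le_of_le_one_left (hlam0 i) (hl1 i)).trans (not_lt.mp hi)
  have hent : ∀ i j, ‖(Vᴴ * K * V) i j‖ ≤
      μ * min (lam i) (lam j) ^ (1 - α) * max (lam i) (lam j) ^ α := by
    intro i j
    refine le_of_eq_of_le ?_ (hgeo i j)
    rw [Matrix.mul_assoc]
    rfl
  have hT : ∀ k j, l k * ‖(Vᴴ * K * V) k j‖ ≤ μ * (ε * c) := by
    intro k j
    calc _ ≤ l k * (μ * min (lam k) (lam j) ^ (1 - α) * max (lam k) (lam j) ^ α) :=
          mul_le_mul_of_nonneg_left (hent k j) (hl0 k)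
      _ = μ * (l k * (min (lam k) (lam j) ^ (1 - α) * max (lam k) (lam j) ^ α)) := by ring
      _ ≤ _ := mul_le_mul_of_nonneg_left (mul_geometricMean_le (hl0 k) (hl1 k) (hlam0 k) (hlam0 j)
          (hlamS k) (hlamS j) hε (hlε k) hα0 hα) hμ.le
  have hT' : ∀ k j, l k * ‖(Vᴴ * K * V) j k‖ ≤ μ * (ε * c) := by
    intro k j
    calc _ ≤ l k * (μ * min (lam j) (lam k) ^ (1 - α) * max (lam j) (lam k) ^ α) :=
          mul_le_mul_of_nonneg_left (hent j k) (hl0 k)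
      _ = μ * (l k * (min (lam k) (lam j) ^ (1 - α) * max (lam k) (lam j) ^ α)) := by
          rw [min_comm, max_comm]; ring
      _ ≤ _ := mul_le_mul_of_nonneg_left (mul_geometricMean_le (hl0 k) (hl1 k) (hlam0 k) (hlam0 j)
          (hlamS k) (hlamS j) hε (hlε k) hα0 hα) hμ.le
  set R := μ * c * ((1 + ρ⁻¹) * ‖ΔS‖) with hR
  have hR0 : 0 ≤ R := by positivity
  -- A kept index has `ε < lam i`, so the factor `ε` left by `hT` is absorbed into `l i * lam i`.
  have hlR : ∀ i, ε < lam i → l i * (μ * (ε * c)) ≤ R := by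
    intro i hi
    calc l i * (μ * (ε * c)) = μ * c * (l i * ε) := by ring
      _ ≤ μ * c * (l i * lam i) := by
          have := hl0 i
          gcongr
      _ ≤ R := mul_le_mul_of_nonneg_left (hkept i hi) (by positivity)
  have hcard : (Fintype.card (Kept lam ε) : ℝ) ≤ n := by
    exact_mod_cast (Fintype.card_subtype_le _).trans_eq (Fintype.card_fin n)
  rw [overlap_congruence_eq_submatrix hV, compressed_projection_eq hV hVt,
    thresholded_eq_submatrix]
  refine (norm_le_card_mul_of_entry_le _ (c := 3 * (n : ℝ) ^ 2 * R) (by positivity)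
    fun i j => ?_).trans ?_
  · exact norm_compression_entry_le hl0 hl1 (norm_discard_entry_le _) hT hT' (hlR i i.2)
      (hlR j j.2)
  · calc _ ≤ n * (3 * (n : ℝ) ^ 2 * R) := by gcongr
      _ = _ := by rw [hR]; ring

/-- In its own eigenbasis `S` is diagonal, and on the diagonal the weighted mean is `lam i` itself.
Hence the estimate for `H` also covers `S`. -/
theorem IsEigendecomposition.geometricMeanBound (hV : IsEigendecomposition S V lam)
    (hS : S.PosSemidef) : GeometricMeanBound S V lam 1 α := by
  intro i j
  have h0 := hV.eigenvalue_nonneg hS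
  have h1 : star (V.col i) ⬝ᵥ (S *ᵥ V.col j) = (Vᴴ * S * V) i j := by
    rw [Matrix.mul_assoc]; rfl
  rw [h1, hV.diagonalize, one_mul]
  by_cases hij : i = j
  · subst hij
    rw [diagonal_apply_eq, min_self, max_self, Complex.norm_real, Real.norm_of_nonneg (h0 i)]
    rcases (h0 i).eq_or_lt with h | h
    · rw [← h]; exact mul_nonneg (Real.rpow_nonneg le_rfl _) (Real.rpow_nonneg le_rfl _)
    · rw [← Real.rpow_add h]; simp
  · rw [diagonal_apply_ne _ hij, norm_zero]
    exact mul_nonneg (Real.rpow_nonneg (le_min (h0 i) (h0 j)) _)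
      (Real.rpow_nonneg ((h0 i).trans (le_max_left _ _)) _)

theorem thresholded_add (M N V : Matrix (Fin n) (Fin n) ℂ) (lam : Fin n → ℝ) (ε : ℝ) :
    thresholded (M + N) V lam ε = thresholded M V lam ε + thresholded N V lam ε := by
  simp only [thresholded, Matrix.mul_add, Matrix.add_mul]

theorem thresholded_isHermitian {M : Matrix (Fin n) (Fin n) ℂ} (hM : M.IsHermitian)
    (V : Matrix (Fin n) (Fin n) ℂ) (lam : Fin n → ℝ) (ε : ℝ) :
    (thresholded M V lam ε).IsHermitian :=
  isHermitian_conjTranspose_mul_mul _ hM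

theorem IsEigendecomposition.thresholded_posDef (hV : IsEigendecomposition S V lam)
    (hε : 0 < ε) : (thresholded S V lam ε).PosDef := by
  rw [hV.thresholded_eq, posDef_diagonal_iff]
  exact fun i => by exact_mod_cast hε.trans i.2

theorem norm_overlap_congruence_add_sub_le (hV : IsEigendecomposition S V lam)
    (hVt : IsEigendecomposition (S + ΔS) Vt lamt) (K Δ : Matrix (Fin n) (Fin n) ℂ) :
    ‖(overlap V Vt lam lamt ε)ᴴ * thresholded (K + Δ) Vt lamt ε * overlap V Vt lam lamt ε -
      thresholded K V lam ε‖ ≤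
    ‖(overlap V Vt lam lamt ε)ᴴ * thresholded K Vt lamt ε * overlap V Vt lam lamt ε -
      thresholded K V lam ε‖ + ‖Δ‖ := by
  have hW := norm_overlap_le_one (ε := ε) hV hVt
  have hVtn := norm_le_one_of_conjTranspose_mul_self (hVt.keptColumns_isometry (ε := ε))
  rw [thresholded_add, Matrix.mul_add, Matrix.add_mul, add_sub_right_comm]
  refine (norm_add_le _ _).trans ?_
  gcongr
  exact (norm_conjTranspose_mul_mul_le hW hW _).trans
    (norm_conjTranspose_mul_mul_le hVtn hVtn Δ)

end Thresholding

/-! ### The main theorem -/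

theorem theorem2p4 {n : ℕ} (H S ΔH ΔS : Matrix (Fin n) (Fin n) ℂ)
    (hH : H.IsHermitian) (hS : S.PosSemidef) (hΔH : ΔH.IsHermitian) (hΔS : ΔS.IsHermitian)
    (V Vt : Matrix (Fin n) (Fin n) ℂ) (lam lamt : Fin n → ℝ)
    (hV : IsEigendecomposition S V lam) (hVt : IsEigendecomposition (S + ΔS) Vt lamt)
    (ε μ α ρ : ℝ) (m : ℕ) (hε : 0 < ε) (hμ : 0 < μ) (hα0 : 0 ≤ α) (hα : α ≤ 1 / 2) (hρ : 0 < ρ)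
    (hgeo : GeometricMeanBound H V lam μ α)
    (hgap : SpectralGap lam m ‖ΔS‖ ε ρ)
    (hnoise : (1 + ρ⁻¹) * ‖ΔS‖ / ε ≤ 1)
    (A B : Matrix (Kept lam ε) (Kept lam ε) ℂ)
    (hA : A = thresholded H V lam ε) (hB : B = thresholded S V lam ε)
    (At Bt : Matrix (Kept lamt ε) (Kept lamt ε) ℂ)
    (hAt : At = thresholded (H + ΔH) Vt lamt ε) (hBt : Bt = thresholded (S + ΔS) Vt lamt ε)
    (χ : ℝ) (hχ : χ = errorLevel S μ α ρ ε ‖ΔS‖ ‖ΔH‖) :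
    (∃ A' B' : Matrix (Kept lam ε) (Kept lam ε) ℂ,
      StarCongruent At Bt A' B' ∧
      (∀ (q : ℕ) (E : Fin q → ℝ), IsEigenvalueSequence At Bt E ↔ IsEigenvalueSequence A' B' E) ∧
      √(‖A' - A‖ ^ 2 + ‖B' - B‖ ^ 2) ≤ χ) ∧
    ∀ (E : Fin m → ℝ) (E₀ : ℝ) (x₀ : Kept lam ε → ℂ),
      IsEigenvalueSequence A B E →
      (∀ j : Fin m, j.val = 0 → E₀ = E j) →
      IsPairEigenvector A B E₀ x₀ → star x₀ ⬝ᵥ x₀ = 1 →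
      n * χ ≤ ε →
      (∀ j : Fin m, j.val = 1 →
        Real.arcsin (n * χ / ε) ≤ Real.arctan (E j) - Real.arctan E₀) →
      ∃ Et₀ : ℝ, IsLeast (pairEigenvalues At Bt) Et₀ ∧
        |Real.arctan E₀ - Real.arctan Et₀| ≤ Real.arcsin (n * χ / eigenangleDist A B x₀) := by
  have hnoise' : (1 + ρ⁻¹) * ‖ΔS‖ ≤ ε := (div_le_one hε).mp hnoise
  have hα1 : α ≤ 1 := by linarith
  obtain ⟨W', hWW', hW'W⟩ := exists_overlap_inverse hV hVt hε hρ hgap hnoise'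
  set W := overlap V Vt lam lamt ε with hW
  have hcong : StarCongruent At Bt (Wᴴ * At * W) (Wᴴ * Bt * W) :=
    ⟨W, W', hWW', hW'W, rfl, rfl⟩
  have hbound : √(‖Wᴴ * At * W - A‖ ^ 2 + ‖Wᴴ * Bt * W - B‖ ^ 2) ≤ χ := by
    have hA1 := (norm_overlap_congruence_add_sub_le (ε := ε) hV hVt H ΔH).trans
      (add_le_add_left (norm_overlap_congruence_sub_le hS hV hVt hε hμ hα0 hα1 hρ hgeo hgap
        hnoise') _)
    have hB1 := (norm_overlap_congruence_add_sub_le (ε := ε) hV hVt S ΔS).trans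
      (add_le_add_left (norm_overlap_congruence_sub_le hS hV hVt hε one_pos hα0 hα1 hρ
        (hV.geometricMeanBound hS) hgap hnoise') _)
    rw [← hW, ← hAt, ← hA] at hA1
    rw [← hW, ← hBt, ← hB] at hB1
    refine Real.sqrt_le_sqrt (pow_add_pow_le (norm_nonneg _) (norm_nonneg _) two_ne_zero)
      |>.trans ?_
    rw [Real.sqrt_sq (by positivity), hχ, errorLevel]
    obtain ⟨i⟩ := hgap.nonempty_kept
    have hn : (1 : ℝ) ≤ (n : ℝ) ^ 3 :=
      one_le_pow₀ (by exact_mod_cast (Nat.zero_le _).trans_lt i.1.2)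
    have hc : 1 ≤ (‖S‖ / ε) ^ α := by
      refine Real.one_le_rpow ?_ hα0
      rw [one_le_div hε]
      exact i.2.le.trans (hV.eigenvalue_le_norm i)
    have hρ1 : 1 ≤ 1 + ρ⁻¹ := by linarith [inv_pos.mpr hρ]
    -- The estimates for `A` and `B` use `3 * μ` and `3 * 1`; the remaining 3 in `3 * (2 + μ)`
    -- absorbs the bare `‖ΔS‖`, since all its other factors are at least 1.
    have hext : ‖ΔS‖ ≤ (n : ℝ) ^ 3 * (1 + ρ⁻¹) * (‖S‖ / ε) ^ α * ‖ΔS‖ :=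
      le_mul_of_one_le_left (norm_nonneg _)
        (one_le_mul_of_one_le_of_one_le (one_le_mul_of_one_le_of_one_le hn hρ1) hc)
    have hx0 : 0 ≤ (n : ℝ) ^ 3 * (1 + ρ⁻¹) * (‖S‖ / ε) ^ α * ‖ΔS‖ := (norm_nonneg _).trans hext
    linarith
  refine ⟨⟨_, _, hcong, fun q E => ⟨hcong.symm.isEigenvalueSequence,
    hcong.isEigenvalueSequence⟩, hbound⟩, ?_⟩
  intro E E₀ x₀ hE hE₀ hx₀ hx₀1 hnχ hgapE
  have hm : 0 < m := hgap.1
  obtain rfl : E₀ = E ⟨0, hm⟩ := hE₀ _ rfl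
  have := hgap.nonempty_kept
  have hAt' : (Wᴴ * At * W).IsHermitian := by
    rw [hAt]
    exact isHermitian_conjTranspose_mul_mul _ (thresholded_isHermitian (hH.add hΔH) _ _ _)
  have hinj : Function.Injective W.mulVec := by
    intro x y hxy
    rw [← one_mulVec x, ← one_mulVec y, ← hW'W, ← mulVec_mulVec, ← mulVec_mulVec]
    exact congrArg (W' *ᵥ ·) hxy
  have hBt' : (Wᴴ * Bt * W).PosDef := by
    rw [hBt]
    exact (hVt.thresholded_posDef hε).conjTranspose_mul_mul_same hinj
  -- The minimum of the Rayleigh quotient of the congruent pair is its least eigenvalue, and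
  -- congruence carries it to `(At, Bt)`.
  obtain ⟨F, w, hw, hF⟩ := exists_min_pairEigenvector hAt' hBt'
  refine ⟨F, ⟨hcong.pairEigenvalues_subset ⟨w, hw⟩, fun G hG => ?_⟩, ?_⟩
  · obtain ⟨y, hy⟩ := hcong.symm.pairEigenvalues_subset hG
    have h := hF y
    rw [hy.quadForm_eq] at h
    exact le_of_mul_le_mul_right h (quadForm_pos hBt' hy.1)
  · have hAh : A.IsHermitian := hA ▸ thresholded_isHermitian hH _ _ _
    have hBp : B.PosDef := hB ▸ hV.thresholded_posDef hε
    have hBε : ∀ y, ε * sqNorm y ≤ quadForm B y := by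
      intro y
      rw [hB, hV.thresholded_eq, quadForm_diagonal (fun i : Kept lam ε => lam i), sqNorm,
        Finset.mul_sum]
      refine Finset.sum_le_sum fun i _ => ?_
      gcongr
      exact i.2.le
    have hx₀1' : sqNorm x₀ = 1 := by
      rw [star_dotProduct_self] at hx₀1
      exact_mod_cast hx₀1
    exact abs_arctan_sub_arctan_le hAh hBp hBt' hε hBε hbound hm hgap.2.1 hE hx₀ hx₀1' hnχ hgapE
      hw hF
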